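/- \textbf{Setting.} Let $d\in\{2,3\}$, let $k,l\ge 1$ be integers (velocity and pressure degrees; $k=l$ is the equal-order case), and let $\kappa>0$, $Q\ge 1$. Let $\Omega\subset\mathbb{R}^d$ be a bounded polytopal domain: open, connected, nonempty, equal to the interior of its closure (as is every domain with Lipschitz boundary), with boundary $\Gamma$ and outward unit normal $\boldsymbol n$. Let $\mathcal T$ be a conforming (face-to-face) simplicial triangulation of $\Omega$ with element diameters $h_e$ and $h=\max_e h_e$, which is shape-regular (each element contains a ball of radius $h_e/\kappa$) and quasi-uniform ($h/h_e\le Q$ for all elements). Let $X_h$ be the space of continuous vector fields $\boldsymbol v:\overline\Omega\to\mathbb{R}^d$ that are polynomials of degree $\le k$ on each element and vanish on $\Gamma$, and $Y_h$ the space of continuous functions $q:\overline\Omega\to\mathbb{R}$ that are polynomials of degree $\le l$ on each element and have zero mean on $\Omega$. Write $(\cdot,\cdot)$ and $\|\cdot\|$ for the $L^2(\Omega)$ inner product and norm, $(\cdot,\cdot)_\Gamma$ for the $L^2(\Gamma)$ inner product (derivatives of discrete functions on $\Gamma$ being taken from the adjacent element), $\|\nabla\nu\|_\infty$ for the $L^\infty$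 norm of the Euclidean length of $\nabla\nu$, $\nabla^{\mathrm s}\boldsymbol u=\frac12(\nabla\boldsymbol u+\nabla^{\top}\boldsymbol u)$ and $(\nabla^{\top}\boldsymbol u\,\nabla\nu)_i=\sum_j\partial_i u_j\,\partial_j\nu$. For $d=2$ the cross product and the curl are the scalars $\boldsymbol a\times\boldsymbol n=a_1n_2-a_2n_1$ and $\nabla\times\boldsymbol u=\partial_1u_2-\partial_2u_1$. \textbf{Lemma (Unique solvability of the boundary-vorticity stabilisation in stress-divergence form).} There is a constant $C>0$, depending only on $d,k,l,\kappa,Q$, such that the following holds for all $\Omega$ and $\mathcal T$ as above. Let $\boldsymbol f\in[L^2(\Omega)]^d$, $\sigma>0$, and let $\nu\in W^{1,\infty}(\Omega)$ (its representative continuous on $\overline\Omega$) satisfy $0<\nu_{\min}\le\nu\le\nu_{\max}<\infty$. Let the stabilisation parameter $\delta$ satisfy $$0<\delta\le\min\left\{\frac1{3\sigma},\ \frac{\nu_{\min}h^2/12}{h^2\|\nabla\nu\|_\infty^2+C\nu_{\max}^2}\right\}.$$ Then the bilinear form $$A_{\mathrm{SD}}((\boldsymbol v,q),(\boldsymbol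 u,p))=\sigma(\boldsymbol u,\boldsymbol v)+(2\nu\nabla^{\mathrm s}\boldsymbol u,\nabla^{\mathrm s}\boldsymbol v)-(p,\nabla\cdot\boldsymbol v)+(q,\nabla\cdot\boldsymbol u)+\delta(\nabla q,\nabla p+\sigma\boldsymbol u-2\nabla^{\top}\boldsymbol u\nabla\nu)+\delta(\nabla q\times\boldsymbol n,\nu\nabla\times\boldsymbol u)_\Gamma$$ satisfies, for all $\boldsymbol v\in X_h$ and $q\in Y_h$, $$A_{\mathrm{SD}}((\boldsymbol v,q),(\boldsymbol v,q))\ \ge\ \tfrac12\left(\sigma\|\boldsymbol v\|^2+\nu_{\min}\|\nabla\boldsymbol v\|^2+\delta\|\nabla q\|^2\right),$$ and there is exactly one pair $(\boldsymbol u_h,p_h)\in X_h\times Y_h$ such that for all $\boldsymbol v_h\in X_h$ and $q_h\in Y_h$ $$\sigma(\boldsymbol u_h,\boldsymbol v_h)+(2\nu\nabla^{\mathrm s}\boldsymbol u_h,\nabla^{\mathrm s}\boldsymbol v_h)-(p_h,\nabla\cdot\boldsymbol v_h)=(\boldsymbol v_h,\boldsymbol f),$$ $$(q_h,\nabla\cdot\boldsymbol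 u_h)+\delta(\nabla q_h,\nabla p_h+\sigma\boldsymbol u_h-2\nabla^{\top}\boldsymbol u_h\nabla\nu-\boldsymbol f)+\delta(\nabla q_h\times\boldsymbol n,\nu\nabla\times\boldsymbol u_h)_\Gamma=0.$$ -/

import Mathlib

open MeasureTheory
open scoped ENNReal Matrix ContDiff RealInnerProductSpace

noncomputable section

namespace BVS

/-- Euclidean space `ℝ^d`. -/
abbrev Vec (d : ℕ) := EuclideanSpace ℝ (Fin d)

/-! ### Triangulations -/

/-- The closed element (simplex) with vertex set `e`. -/
def elt {d : ℕ} (e : Finset (Vec d)) : Set (Vec d) := convexHull ℝ (e : Set (Vec d))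

/-- `T` (a finite set of vertex sets) is a conforming simplicial triangulation of the bounded domain
`Ω`: the elements are nondegenerate `d`-simplices, any two of them meet exactly in the simplex
spanned by their common vertices (possibly empty), and they cover the closure of `Ω`.  The domain is
open, connected and nonempty and lies nowhere on both sides of its boundary, which holds for every
domain with Lipschitz boundary. -/
structure IsTriangulation {d : ℕ} (Ω : Set (Vec d)) (T : Finset (Finset (Vec d))) : Prop where
  isConnected : IsConnected Ω
  interior_closure : interior (closure Ω) = Ω
  card_eq : ∀ e ∈ T, e.card = d + 1
  affineIndependent : ∀ e ∈ T, AffineIndependent ℝ ((↑) : e → Vec d)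
  inter_eq : ∀ e ∈ T, ∀ e' ∈ T,
    elt e ∩ elt e' = convexHull ℝ ((e : Set (Vec d)) ∩ (e' : Set (Vec d)))
  closure_eq : closure Ω = ⋃ e ∈ T, elt e

/-- The element size `h_e`. -/
def eltSize {d : ℕ} (e : Finset (Vec d)) : ℝ := Metric.diam (elt e)

/-- The mesh size `h`, the maximum of the element sizes. -/
def meshSize {d : ℕ} (T : Finset (Finset (Vec d))) : ℝ := ⨆ e : T, eltSize (e : Finset (Vec d))

/-- Shape regularity with constant `κ > 0`: every element contains a ball of radius `h_e / κ`. -/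
def ShapeRegular {d : ℕ} (κ : ℝ) (T : Finset (Finset (Vec d))) : Prop :=
  ∀ e ∈ T, ∃ c, Metric.closedBall c (eltSize e / κ) ⊆ elt e

/-- Global quasi-uniformity with constant `Q`: `h / h_e ≤ Q` for every element. -/
def QuasiUniform {d : ℕ} (Q : ℝ) (T : Finset (Finset (Vec d))) : Prop :=
  ∀ e ∈ T, meshSize T / eltSize e ≤ Q

/-! ### Finite element spaces

Discrete functions live on the closure of `Ω` and are extended by zero to all of `ℝ^d`, so that
equality of functions on `ℝ^d` is equality on the closure of `Ω`. -/

/-- Continuous functions on the closure of `Ω` that are polynomials of total degree at most `k` on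
every element. -/
def PwPoly {d : ℕ} (Ω : Set (Vec d)) (T : Finset (Finset (Vec d))) (k : ℕ) :
    Set (Vec d → ℝ) :=
  {q | ContinuousOn q (closure Ω) ∧ (∀ x ∉ closure Ω, q x = 0) ∧
    ∀ e ∈ T, ∃ P : MvPolynomial (Fin d) ℝ, P.totalDegree ≤ k ∧
      ∀ x ∈ elt e, q x = MvPolynomial.eval (fun i => x i) P}

/-- The discrete velocity space `X_h`: piecewise polynomial fields vanishing on the boundary. -/
def velocitySpace {d : ℕ} (Ω : Set (Vec d)) (T : Finset (Finset (Vec d))) (k : ℕ) :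
    Set (Vec d → Vec d) :=
  {v | (∀ i, (fun x => v x i) ∈ PwPoly Ω T k) ∧ ∀ x ∈ frontier Ω, v x = 0}

/-- The discrete pressure space `Y_h`: piecewise polynomial functions with zero mean. -/
def pressureSpace {d : ℕ} (Ω : Set (Vec d)) (T : Finset (Finset (Vec d))) (k : ℕ) :
    Set (Vec d → ℝ) :=
  {q | q ∈ PwPoly Ω T k ∧ ∫ x in Ω, q x = 0}

/-! ### The viscosity -/

/-- `G` is the weak gradient of `ν` in `Ω`. -/
def IsWeakGradient {d : ℕ} (Ω : Set (Vec d)) (ν : Vec d → ℝ) (G : Vec d → Vec d) : Prop :=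
  ∀ φ : Vec d → ℝ, ContDiff ℝ ∞ φ → HasCompactSupport φ → tsupport φ ⊆ Ω →
    ∀ i, ∫ x in Ω, ν x * gradient φ x i = - ∫ x in Ω, G x i * φ x

/-- `ν ∈ W^{1,∞}(Ω)` with weak gradient `G`.  The function `ν` is the representative that is
continuous up to the boundary (on a Lipschitz domain every class in `W^{1,∞}` has exactly one), whose
values on the boundary are the trace. -/
structure IsW1Infty {d : ℕ} (Ω : Set (Vec d)) (ν : Vec d → ℝ) (G : Vec d → Vec d) : Prop where
  continuousOn : ContinuousOn ν (closure Ω)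
  memLp : MemLp ν ∞ (volume.restrict Ω)
  memLp_grad : MemLp G ∞ (volume.restrict Ω)
  weakGradient : IsWeakGradient Ω ν G

/-- The norm of a vector field `G` (with Euclidean pointwise norm) in `L^∞(Ω)`. -/
def supNorm {d : ℕ} (Ω : Set (Vec d)) (G : Vec d → Vec d) : ℝ :=
  (eLpNorm G ∞ (volume.restrict Ω)).toReal

/-! ### Differential operators

A piecewise polynomial continuous function is classically differentiable off the element boundaries,
which form a null set, and its classical gradient is its weak gradient; hence `gradient` and `fderiv`
are used in integrals over `Ω`.  On a face of an element the one-sided derivatives, taken within the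
closed element, are used. -/

/-- The Jacobian matrix of the linear map `L`; for `L` the derivative of `u`, the entry `i j` is
`∂_j u_i`. -/
def jac {d : ℕ} (L : Vec d →L[ℝ] Vec d) : Matrix (Fin d) (Fin d) ℝ :=
  fun i j => L (EuclideanSpace.single j 1) i

/-- The velocity gradient `∇u`. -/
def grad {d : ℕ} (u : Vec d → Vec d) (x : Vec d) : Matrix (Fin d) (Fin d) ℝ := jac (fderiv ℝ u x)

/-- The symmetric gradient, half of `∇u + (∇u)ᵀ`. -/
def symGrad {d : ℕ} (u : Vec d → Vec d) (x : Vec d) : Matrix (Fin d) (Fin d) ℝ :=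
  (1 / 2 : ℝ) • (grad u x + (grad u x)ᵀ)

/-- The divergence. -/
def divg {d : ℕ} (u : Vec d → Vec d) (x : Vec d) : ℝ := (grad u x).trace

/-- The Frobenius product. -/
def frob {d : ℕ} (A B : Matrix (Fin d) (Fin d) ℝ) : ℝ := ∑ i, ∑ j, A i j * B i j

/-- `(a × n) · (∇ × u)`, where `J` is the Jacobian of `u`, written uniformly in `d` through the
antisymmetric matrices `a_i n_j - a_j n_i` and `∂_i u_j - ∂_j u_i`. See the two lemmas below for
`d = 2` (scalar products and curls) and `d = 3`. -/
def crossCurl {d : ℕ} (a n : Vec d) (J : Matrix (Fin d) (Fin d) ℝ) : ℝ :=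
  (1 / 2) * ∑ i, ∑ j, (a i * n j - a j * n i) * (J j i - J i j)

theorem crossCurl_two (a n : Vec 2) (J : Matrix (Fin 2) (Fin 2) ℝ) :
    crossCurl a n J = (a 0 * n 1 - a 1 * n 0) * (J 1 0 - J 0 1) := by
  simp [crossCurl, Fin.sum_univ_two]; ring

theorem crossCurl_three (a n : Vec 3) (J : Matrix (Fin 3) (Fin 3) ℝ) :
    crossCurl a n J = (crossProduct (fun i => a i) (fun i => n i)) ⬝ᵥ
      ![J 2 1 - J 1 2, J 0 2 - J 2 0, J 1 0 - J 0 1] := by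
  simp [crossCurl, Fin.sum_univ_three, cross_apply, dotProduct]; ring

/-! ### The boundary integral -/

open Classical in
/-- The vertex set of the face of the element `e` opposite to its vertex `a`. -/
def face {d : ℕ} (e : Finset (Vec d)) (a : Vec d) : Finset (Vec d) := e.erase a

/-- A normal vector, outward from the element `e`, on the face opposite to the vertex `a`: the
component orthogonal to that face of the vector from `a` to the centroid of the face. -/
def preNormal {d : ℕ} (e : Finset (Vec d)) (a : Vec d) : Vec d :=
  (vectorSpan ℝ (face e a : Set (Vec d)))ᗮ.starProjection ((face e a).centroid ℝ id - a)

/-- The outward unit normal of the element `e` on the face opposite to the vertex `a`. -/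
def outerNormal {d : ℕ} (e : Finset (Vec d)) (a : Vec d) : Vec d :=
  ‖preNormal e a‖⁻¹ • preNormal e a

open Classical in
/-- The boundary term `(∇q × n, ν ∇ × u)_Γ`, with `Γ` split into the element faces lying on it. -/
def boundaryTerm {d : ℕ} (Ω : Set (Vec d)) (T : Finset (Finset (Vec d))) (ν : Vec d → ℝ)
    (q : Vec d → ℝ) (u : Vec d → Vec d) : ℝ :=
  ∑ e ∈ T, ∑ a ∈ e with elt (face e a) ⊆ frontier Ω,
    ∫ x in elt (face e a),
      ν x * crossCurl (gradientWithin q (elt e) x) (outerNormal e a) (jac (fderivWithin ℝ u (elt e) x))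
      ∂(μHE[d - 1])

/-! ### The discrete problem -/

/-- The left-hand side of the momentum equation:
`σ (u, v) + (2 ν ∇ˢu, ∇ˢv) - (p, ∇ · v)`. -/
def momentumForm {d : ℕ} (Ω : Set (Vec d)) (σ : ℝ) (ν : Vec d → ℝ)
    (u : Vec d → Vec d) (p : Vec d → ℝ) (v : Vec d → Vec d) : ℝ :=
  σ * (∫ x in Ω, ⟪u x, v x⟫) + (∫ x in Ω, 2 * ν x * frob (symGrad u x) (symGrad v x))
    - ∫ x in Ω, p x * divg v x

/-- `2 (∇u)ᵀ ∇ν`, with `G = ∇ν`. -/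
def viscousResidual {d : ℕ} (G : Vec d → Vec d) (u : Vec d → Vec d) (x : Vec d) : Vec d :=
  WithLp.toLp 2 ((2 : ℝ) • ((grad u x)ᵀ *ᵥ fun i => G x i))

/-- The left-hand side of the stabilised continuity equation with force `f`:
`(q, ∇ · u) + δ (∇q, ∇p + σ u - 2 (∇u)ᵀ ∇ν - f) + δ (∇q × n, ν ∇ × u)_Γ`. -/
def continuityForm {d : ℕ} (Ω : Set (Vec d)) (T : Finset (Finset (Vec d))) (σ δ : ℝ)
    (ν : Vec d → ℝ) (G f : Vec d → Vec d)
    (u : Vec d → Vec d) (p : Vec d → ℝ) (q : Vec d → ℝ) : ℝ :=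
  (∫ x in Ω, q x * divg u x)
    + δ * (∫ x in Ω, ⟪gradient q x, gradient p x + σ • u x - viscousResidual G u x - f x⟫)
    + δ * boundaryTerm Ω T ν q u

/-- `(u, p)` solves the stress-divergence Galerkin system with boundary-vorticity stabilisation,
with velocity degree `k` and pressure degree `l`. -/
structure IsDiscreteSolution {d : ℕ} (Ω : Set (Vec d)) (T : Finset (Finset (Vec d))) (k l : ℕ)
    (σ δ : ℝ) (ν : Vec d → ℝ) (G f : Vec d → Vec d)
    (u : Vec d → Vec d) (p : Vec d → ℝ) : Prop where
  velocity_mem : u ∈ velocitySpace Ω T k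
  pressure_mem : p ∈ pressureSpace Ω T l
  momentum : ∀ v ∈ velocitySpace Ω T k, momentumForm Ω σ ν u p v = ∫ x in Ω, ⟪v x, f x⟫
  continuity : ∀ q ∈ pressureSpace Ω T l, continuityForm Ω T σ δ ν G f u p q = 0

/-- The stabilised bilinear form `A_SD((v, q), (u, p))`. -/
def formSD {d : ℕ} (Ω : Set (Vec d)) (T : Finset (Finset (Vec d))) (σ δ : ℝ)
    (ν : Vec d → ℝ) (G : Vec d → Vec d)
    (v : Vec d → Vec d) (q : Vec d → ℝ) (u : Vec d → Vec d) (p : Vec d → ℝ) : ℝ :=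
  momentumForm Ω σ ν u p v + continuityForm Ω T σ δ ν G 0 u p q

/-- The norm `(σ ‖v‖² + ν_min ‖∇v‖² + δ ‖∇q‖²)^{1/2}`. -/
def energyNorm {d : ℕ} (Ω : Set (Vec d)) (σ νmin δ : ℝ)
    (v : Vec d → Vec d) (q : Vec d → ℝ) : ℝ :=
  Real.sqrt (σ * (∫ x in Ω, ‖v x‖ ^ 2) + νmin * (∫ x in Ω, frob (grad v x) (grad v x))
    + δ * ∫ x in Ω, ‖gradient q x‖ ^ 2)

end BVS

end

/-!
Solvability and coercivity of the stabilised problem rest on four ingredients.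

*Inverse inequality.* On the finite-dimensional space of polynomials of bounded degree the
supremum over the unit ball is dominated by the `L²` norm over any concentric ball
(`exists_sq_le_integral_unit`); scaling gives `sup |P|² ≤ C h⁻ᵈ ∫ |P|²` on each element of a
shape-regular triangulation. A face of an element has area `O(hᵈ⁻¹)`, because it is covered by a
Lipschitz image of the unit cube of `ℝᵈ⁻¹` (`hausdorffMeasure_convexHull_le`). Together these
bound the boundary term by `C ν_max h⁻¹ ‖∇q‖ ‖∇v‖` (`exists_abs_boundaryTerm_le`).

*Korn's inequality.* Extended by zero, a discrete velocity is a compactly supported Lipschitz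
function on `ℝᵈ` (`exists_lipschitzWith_velocity`). For such functions the directions of two
derivatives may be interchanged under the integral (`integral_lineDeriv_mul_lineDeriv_comm`),
whence `2 ‖∇ˢv‖² = ‖∇v‖² + ‖∇ · v‖²` and `(2 ν ∇ˢv, ∇ˢv) ≥ ν_min ‖∇v‖²` (`integral_frob_grad_le`).

*Coercivity.* On the diagonal of the stabilised form the two pressure-divergence terms cancel.
Young's inequality spends a share `δ / 6` of `δ ‖∇q‖²` on each of the three indefinite terms; the
rest of these is absorbed by `σ ‖v‖²` and `ν_min ‖∇v‖²` under the two upper bounds for `δ`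
(`half_energyNorm_sq_le_formSD`).

*Definiteness.* If the energy norm of `(v, q)` vanishes, then `v = 0`, and `q` is constant on
every element, hence takes finitely many values on the connected domain and is constant; its mean
being zero, it vanishes (`pressure_eq_zero_of_integral`). Thus the stabilised form is a positive
definite bilinear form on the finite-dimensional space `X_h × Y_h` and represents every functional
exactly once (`existsUnique_of_posDef`).
-/

namespace BVS

/-! ### Polynomials on Euclidean space -/

/-- The polynomial function on `ℝ^d` defined by `P`. -/
noncomputable def evalPoly {d : ℕ} (P : MvPolynomial (Fin d) ℝ) (x : Vec d) : ℝ :=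
  MvPolynomial.eval (fun i => x i) P

variable {d : ℕ}

theorem continuous_evalPoly (P : MvPolynomial (Fin d) ℝ) : Continuous (evalPoly P) := by
  unfold evalPoly
  exact (MvPolynomial.continuous_eval P).comp (by fun_prop)

theorem hasFDerivAt_evalPoly (P : MvPolynomial (Fin d) ℝ) (x : Vec d) :
    HasFDerivAt (evalPoly P)
      (∑ i, evalPoly (MvPolynomial.pderiv i P) x • EuclideanSpace.proj (𝕜 := ℝ) i) x := by
  induction P using MvPolynomial.induction_on with
  | C a =>
    have : evalPoly (MvPolynomial.C a) = fun _ : Vec d => a := by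
      ext x; simp [evalPoly]
    rw [this]
    simpa [evalPoly] using hasFDerivAt_const a x
  | add P R hP hR =>
    have : evalPoly (P + R) = evalPoly P + evalPoly R := by ext x; simp [evalPoly]
    rw [this]
    refine (hP.add hR).congr_fderiv ?_
    rw [← Finset.sum_add_distrib]
    refine Finset.sum_congr rfl fun i _ => ?_
    rw [← add_smul]; simp [evalPoly]
  | mul_X P j hP =>
    have : evalPoly (P * MvPolynomial.X j) = evalPoly P * fun x : Vec d => x j := by
      ext x; simp [evalPoly]
    rw [this]
    have hj : HasFDerivAt (fun x : Vec d => x j) (EuclideanSpace.proj (𝕜 := ℝ) j) x :=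
      (EuclideanSpace.proj (𝕜 := ℝ) j).hasFDerivAt
    refine (hP.mul hj).congr_fderiv ?_
    ext y
    simp only [evalPoly, add_apply,
      smul_apply, PiLp.proj_apply, smul_eq_mul, sum_apply,
      Finset.mul_sum, MvPolynomial.pderiv_mul, MvPolynomial.pderiv_X, map_add, map_mul,
      MvPolynomial.eval_X, add_mul, Finset.sum_add_distrib]
    rw [add_comm]
    congr 1
    · exact Finset.sum_congr rfl fun i _ => by ring
    · rw [Finset.sum_eq_single j (fun b _ hb => by simp [hb.symm]) (by simp)]
      simp

theorem fderiv_evalPoly_single (P : MvPolynomial (Fin d) ℝ) (x : Vec d) (i : Fin d) :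
    fderiv ℝ (evalPoly P) x (EuclideanSpace.single i 1) = evalPoly (MvPolynomial.pderiv i P) x := by
  rw [(hasFDerivAt_evalPoly P x).fderiv]
  simp

theorem totalDegree_pderiv_le (P : MvPolynomial (Fin d) ℝ) (i : Fin d) :
    (MvPolynomial.pderiv i P).totalDegree ≤ P.totalDegree := by
  rw [MvPolynomial.pderiv_def]
  have : MvPolynomial.mkDerivation ℝ (Pi.single i 1) P =
      ∑ s ∈ P.support, MvPolynomial.pderiv i (MvPolynomial.monomial s (P.coeff s)) := by
    rw [← map_sum, MvPolynomial.support_sum_monomial_coeff, MvPolynomial.pderiv_def]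
  rw [this]
  refine MvPolynomial.totalDegree_finsetSum_le fun s hs => ?_
  rw [MvPolynomial.pderiv_monomial]
  refine (MvPolynomial.totalDegree_monomial_le _ _).trans ?_
  refine le_trans ?_ (MvPolynomial.le_totalDegree hs)
  exact Finsupp.degree_mono tsub_le_self

/-- Composition with a dilation and a translation does not raise the degree. -/
theorem exists_evalPoly_comp_affine (P : MvPolynomial (Fin d) ℝ) (c : Vec d) (h : ℝ) :
    ∃ R : MvPolynomial (Fin d) ℝ, R.totalDegree ≤ P.totalDegree ∧
      ∀ x, evalPoly R x = evalPoly P (c + h • x) := by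
  classical
  refine ⟨∑ s ∈ P.support, MvPolynomial.C (P.coeff s) *
    ∏ i, (MvPolynomial.C (c i) + MvPolynomial.C h * MvPolynomial.X i) ^ s i, ?_, fun x => ?_⟩
  · refine MvPolynomial.totalDegree_finsetSum_le fun s hs => ?_
    refine (MvPolynomial.totalDegree_mul _ _).trans ?_
    rw [MvPolynomial.totalDegree_C, zero_add]
    refine (MvPolynomial.totalDegree_finsetProd _ _).trans ?_
    refine le_trans (Finset.sum_le_sum (g := fun i => s i) fun i _ => ?_) ?_
    · refine (MvPolynomial.totalDegree_pow _ _).trans ?_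
      have : (MvPolynomial.C (c i) + MvPolynomial.C h * MvPolynomial.X i :
          MvPolynomial (Fin d) ℝ).totalDegree ≤ 1 := by
        refine (MvPolynomial.totalDegree_add _ _).trans (max_le (by simp) ?_)
        refine (MvPolynomial.totalDegree_mul _ _).trans ?_
        simp
      simpa using Nat.mul_le_mul_left (s i) this
    · have := MvPolynomial.le_totalDegree hs
      rwa [Finsupp.sum_fintype _ _ (fun _ => rfl)] at this
  · simp only [evalPoly, map_sum, map_mul, map_prod, map_pow, map_add, MvPolynomial.eval_C,
      MvPolynomial.eval_X]
    rw [MvPolynomial.eval_eq']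
    simp

/-! ### An inverse inequality for polynomials -/

/-- On a finite-dimensional space every linear map is dominated by every injective one. -/
theorem exists_norm_le_mul_norm_of_injective {V E F : Type*} [AddCommGroup V] [Module ℝ V]
    [FiniteDimensional ℝ V] [NormedAddCommGroup E] [NormedSpace ℝ E] [NormedAddCommGroup F]
    [NormedSpace ℝ F] (A : V →ₗ[ℝ] E) (hA : Function.Injective A) (S : V →ₗ[ℝ] F) :
    ∃ C : ℝ, 0 < C ∧ ∀ v, ‖S v‖ ≤ C * ‖A v‖ := by
  -- Linear maps out of the finite-dimensional range of `A` are continuous.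
  let φ := LinearEquiv.ofInjective A hA
  let B : LinearMap.range A →L[ℝ] F := LinearMap.toContinuousLinearMap (S ∘ₗ φ.symm.toLinearMap)
  refine ⟨‖B‖ + 1, by positivity, fun v => ?_⟩
  have h1 : B (φ v) = S v := by simp [B]
  have h2 : ‖φ v‖ = ‖A v‖ := rfl
  calc ‖S v‖ = ‖B (φ v)‖ := by rw [h1]
    _ ≤ ‖B‖ * ‖φ v‖ := B.le_opNorm _
    _ ≤ (‖B‖ + 1) * ‖A v‖ := by rw [h2]; gcongr; linarith

theorem eq_zero_of_evalPoly_eq_zero_on_ball (P : MvPolynomial (Fin d) ℝ) {r : ℝ} (hr : 0 < r)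
    (h : ∀ x ∈ Metric.ball (0 : Vec d) r, evalPoly P x = 0) : P = 0 := by
  have hev : ∀ᶠ x : Fin d → ℝ in nhds 0, WithLp.toLp 2 x ∈ Metric.ball (0 : Vec d) r := by
    have hc : Continuous fun x : Fin d → ℝ => (WithLp.toLp 2 x : Vec d) := by fun_prop
    refine hc.continuousAt.eventually_mem ?_
    simpa using Metric.ball_mem_nhds (0 : Vec d) hr
  have := (AnalyticOnNhd.eval_mvPolynomial (𝕜 := ℝ) P).eq_of_eventuallyEq
    (AnalyticOnNhd.eval_mvPolynomial 0) (z₀ := 0) (hev.mono fun x hx => by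
      simpa [evalPoly] using h _ hx)
  exact MvPolynomial.funext fun x => congrFun this x

theorem memLp_of_continuousOn_isCompact {E F : Type*} [TopologicalSpace E]
    [T2Space E] [MeasurableSpace E] [BorelSpace E] [NormedAddCommGroup F]
    [SecondCountableTopology F] {μ : Measure E} {K : Set E} {f : E → F} (hf : ContinuousOn f K)
    (hK : IsCompact K) (hμ : μ K < ⊤) (p : ℝ≥0∞) : MemLp f p (μ.restrict K) := by
  borelize F
  have : IsFiniteMeasure (μ.restrict K) := ⟨by simpa using hμ⟩
  obtain ⟨C, hC⟩ := hK.exists_bound_of_continuousOn hf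
  exact MemLp.of_bound (hf.aemeasurable hK.measurableSet).aestronglyMeasurable C
    ((ae_restrict_iff' hK.measurableSet).2 (Filter.Eventually.of_forall hC))

theorem memLp_evalPoly_closedBall (P : MvPolynomial (Fin d) ℝ) (c : Vec d) (r : ℝ) :
    MemLp (evalPoly P) 2 (volume.restrict (Metric.closedBall c r)) :=
  memLp_of_continuousOn_isCompact (continuous_evalPoly P).continuousOn (isCompact_closedBall c r)
    measure_closedBall_lt_top 2

/-- The supremum of a polynomial over the unit ball is controlled by its mean square over a
concentric ball, with a constant that depends only on the degree and the radius. -/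
theorem exists_sq_le_integral_unit (d m : ℕ) {r : ℝ} (hr : 0 < r) :
    ∃ C : ℝ, 0 < C ∧ ∀ P : MvPolynomial (Fin d) ℝ, P.totalDegree ≤ m →
      ∀ x ∈ Metric.closedBall (0 : Vec d) 1,
        evalPoly P x ^ 2 ≤ C * ∫ y in Metric.closedBall (0 : Vec d) r, evalPoly P y ^ 2 := by
  let V := MvPolynomial.restrictTotalDegree (Fin d) ℝ m
  let μ : Measure (Vec d) := volume.restrict (Metric.closedBall 0 r)
  let A : V →ₗ[ℝ] Lp ℝ 2 μ :=
    { toFun := fun P => (memLp_evalPoly_closedBall P.1 0 r).toLp _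
      map_add' := fun P R => by
        rw [← MemLp.toLp_add]
        congr 1
        ext x; simp [evalPoly]
      map_smul' := fun a P => by
        rw [RingHom.id_apply, ← MemLp.toLp_const_smul]
        congr 1
        ext x; simp [evalPoly, MvPolynomial.smul_eval] }
  let S : V →ₗ[ℝ] C(Metric.closedBall (0 : Vec d) 1, ℝ) :=
    { toFun := fun P => ⟨fun x => evalPoly P.1 x,
        (continuous_evalPoly P.1).comp continuous_subtype_val⟩
      map_add' := fun P R => by ext x; simp [evalPoly]
      map_smul' := fun a P => by ext x; simp [evalPoly, MvPolynomial.smul_eval] }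
  have hA : Function.Injective A := by
    rw [injective_iff_map_eq_zero]
    intro P hP
    have h0 : evalPoly P.1 =ᵐ[μ] 0 := 
      (MemLp.coeFn_toLp (memLp_evalPoly_closedBall P.1 0 r)).symm.trans
        (Lp.eq_zero_iff_ae_eq_zero.1 hP)
    have h1 : evalPoly P.1 =ᵐ[volume.restrict (Metric.ball 0 r)] 0 :=
      ae_restrict_of_ae_restrict_of_subset Metric.ball_subset_closedBall h0
    have h2 := Measure.eqOn_open_of_ae_eq h1 Metric.isOpen_ball
      (continuous_evalPoly P.1).continuousOn continuousOn_const
    exact Subtype.ext (eq_zero_of_evalPoly_eq_zero_on_ball P.1 hr h2)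
  obtain ⟨C, hC, hle⟩ := exists_norm_le_mul_norm_of_injective A hA S
  refine ⟨C ^ 2, by positivity, fun P hP x hx => ?_⟩
  let P' : V := ⟨P, (MvPolynomial.mem_restrictTotalDegree _ _ _).2 hP⟩
  have h1 : |evalPoly P x| ≤ ‖S P'‖ := ContinuousMap.norm_coe_le_norm (S P') ⟨x, hx⟩
  have h2 : ‖A P'‖ ^ 2 = ∫ y in Metric.closedBall (0 : Vec d) r, evalPoly P y ^ 2 := by
    rw [← real_inner_self_eq_norm_sq, L2.inner_def]
    refine integral_congr_ae ?_
    filter_upwards [MemLp.coeFn_toLp (memLp_evalPoly_closedBall P 0 r)] with y hy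
    change inner ℝ ((memLp_evalPoly_closedBall P 0 r).toLp _ y)
      ((memLp_evalPoly_closedBall P 0 r).toLp _ y) = _
    rw [hy]; simp [sq]
  rw [← h2, ← mul_pow, ← sq_abs]
  exact pow_le_pow_left₀ (abs_nonneg _) (h1.trans (hle P')) 2

theorem setIntegral_closedBall_comp_affine (F : Vec d → ℝ) (c : Vec d) {h : ℝ} (hh : 0 < h)
    (r : ℝ) : ∫ y in Metric.closedBall (0 : Vec d) r, F (c + h • y) =
      (h ^ d)⁻¹ * ∫ y in Metric.closedBall c (h * r), F y := by
  rw [Measure.setIntegral_comp_smul_of_pos volume (fun y => F (c + y)) _ hh]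
  have hfin : Module.finrank ℝ (Vec d) = d := by simp
  rw [hfin, smul_closedBall' hh.ne', smul_zero, smul_eq_mul, Real.norm_eq_abs, abs_of_pos hh]
  congr 1
  have hpre : (fun y => c + y) ⁻¹' Metric.closedBall c (h * r) = Metric.closedBall 0 (h * r) := by
    ext y; simp [Metric.mem_closedBall, dist_eq_norm]
  rw [← hpre]
  exact (measurePreserving_add_left volume c).setIntegral_preimage_emb
    (measurableEmbedding_addLeft c) _ _

/-- The scaled inverse inequality: on a ball of radius `h` the square of a polynomial is at most
`C h⁻ᵈ` times its integral over the concentric ball of radius `h / κ`. -/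
theorem exists_sq_le_integral (d m : ℕ) {κ : ℝ} (hκ : 0 < κ) :
    ∃ C : ℝ, 0 < C ∧ ∀ (c : Vec d) (h : ℝ), 0 < h → ∀ P : MvPolynomial (Fin d) ℝ,
      P.totalDegree ≤ m → ∀ x ∈ Metric.closedBall c h,
        evalPoly P x ^ 2 ≤
          C * (h ^ d)⁻¹ * ∫ y in Metric.closedBall c (h / κ), evalPoly P y ^ 2 := by
  obtain ⟨C, hC, hle⟩ := exists_sq_le_integral_unit d m (inv_pos.2 hκ)
  refine ⟨C, hC, fun c h hh P hP x hx => ?_⟩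
  obtain ⟨R, hR, hRe⟩ := exists_evalPoly_comp_affine P c h
  have hx' : h⁻¹ • (x - c) ∈ Metric.closedBall (0 : Vec d) 1 := by
    rw [mem_closedBall_zero_iff, norm_smul, Real.norm_eq_abs, abs_of_pos (inv_pos.2 hh),
      inv_mul_le_iff₀ hh, mul_one]
    simpa [dist_eq_norm] using hx
  have := hle R (hR.trans hP) _ hx'
  simp only [hRe] at this
  rw [smul_inv_smul₀ hh.ne', add_sub_cancel,
    setIntegral_closedBall_comp_affine (fun y => evalPoly P y ^ 2) c hh] at this
  rw [mul_assoc]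
  simpa [div_eq_mul_inv] using this

/-! ### Geometry of a triangulation -/

theorem isCompact_elt (e : Finset (Vec d)) : IsCompact (elt e) :=
  e.finite_toSet.isCompact_convexHull ℝ

theorem convex_elt (e : Finset (Vec d)) : Convex ℝ (elt e) := convex_convexHull ℝ _

theorem measurableSet_elt (e : Finset (Vec d)) : MeasurableSet (elt e) :=
  (isCompact_elt e).measurableSet

theorem volume_frontier_elt (e : Finset (Vec d)) : volume (frontier (elt e)) = 0 :=
  (convex_elt e).addHaar_frontier volume

theorem ae_mem_interior_elt (e : Finset (Vec d)) :
    ∀ᵐ x ∂volume.restrict (elt e), x ∈ interior (elt e) := by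
  have h1 : ∀ᵐ x ∂volume.restrict (elt e), x ∉ frontier (elt e) :=
    ae_restrict_of_ae (compl_mem_ae_iff.2 (volume_frontier_elt e))
  filter_upwards [h1, ae_restrict_mem (measurableSet_elt e)] with x hx hxe
  by_contra hi
  exact hx ⟨subset_closure hxe, hi⟩

theorem elt_subset_closedBall {e : Finset (Vec d)} {c : Vec d} (hc : c ∈ elt e) :
    elt e ⊆ Metric.closedBall c (eltSize e) := fun _ hx =>
  Metric.dist_le_diam_of_mem (isCompact_elt e).isBounded hx hc

theorem elt_mono {e e' : Finset (Vec d)} (h : e ⊆ e') : elt e ⊆ elt e' :=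
  convexHull_mono (by exact_mod_cast h)

theorem elt_face_subset (e : Finset (Vec d)) (a : Vec d) : elt (face e a) ⊆ elt e := by
  classical
  exact elt_mono (by unfold face; exact Finset.erase_subset _ _)

/-- Fewer than `d + 1` points span a null set. -/
theorem volume_convexHull_of_card_le {s : Finset (Vec d)} (hs : s.card ≤ d) :
    volume (convexHull ℝ (s : Set (Vec d))) = 0 := by
  refine measure_mono_null (convexHull_subset_affineSpan _)
    (Measure.addHaar_affineSubspace volume _ fun htop => ?_)
  rcases s.eq_empty_or_nonempty with rfl | hne
  · simp at htop
  have h1 := finrank_vectorSpan_range_le ℝ (fun p : s => (p : Vec d)) (n := s.card - 1)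
    (by have := hne.card_pos; simp; omega)
  have h2 : vectorSpan ℝ (s : Set (Vec d)) = ⊤ := by
    rw [← direction_affineSpan, htop, AffineSubspace.direction_top]
  have h3 : Set.range (fun p : s => (p : Vec d)) = (s : Set (Vec d)) := Subtype.range_coe
  rw [h3, h2] at h1
  simp at h1
  have := hne.card_pos
  omega

namespace IsTriangulation
variable {Ω : Set (Vec d)} {T : Finset (Finset (Vec d))} (hT : IsTriangulation Ω T)
include hT

theorem isOpen : IsOpen Ω := hT.interior_closure ▸ isOpen_interior

theorem isCompact_closure : IsCompact (closure Ω) := by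
  rw [hT.closure_eq]
  exact T.isCompact_biUnion fun e _ => isCompact_elt e

theorem elt_subset {e : Finset (Vec d)} (he : e ∈ T) : elt e ⊆ closure Ω := by
  rw [hT.closure_eq]
  exact Set.subset_biUnion_of_mem (u := fun e => elt e) he

theorem interior_elt_subset {e : Finset (Vec d)} (he : e ∈ T) : interior (elt e) ⊆ Ω :=
  (interior_mono (hT.elt_subset he)).trans hT.interior_closure.subset

theorem interior_elt_nonempty {e : Finset (Vec d)} (he : e ∈ T) : (interior (elt e)).Nonempty := by
  unfold elt
  rw [interior_convexHull_nonempty_iff_affineSpan_eq_top]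
  have h := (hT.affineIndependent e he).affineSpan_eq_top_iff_card_eq_finrank_add_one.2
    (by simp [hT.card_eq e he])
  simpa using h

theorem uniqueDiffOn_elt {e : Finset (Vec d)} (he : e ∈ T) : UniqueDiffOn ℝ (elt e) :=
  uniqueDiffOn_convex (convex_elt e) (hT.interior_elt_nonempty he)

theorem nonempty : T.Nonempty := by
  by_contra h
  rw [Finset.not_nonempty_iff_eq_empty] at h
  have := hT.closure_eq
  subst h
  exact hT.isConnected.nonempty.closure.ne_empty (by simpa using this)

theorem frontier_subset : frontier Ω ⊆ ⋃ e ∈ T, frontier (elt e) := by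
  intro x hx
  have hx' : x ∈ closure Ω \ Ω := by
    rwa [frontier, hT.isOpen.interior_eq] at hx
  have := hx'.1
  rw [hT.closure_eq, Set.mem_iUnion₂] at this
  obtain ⟨e, he, hxe⟩ := this
  refine Set.mem_iUnion₂.2 ⟨e, he, subset_closure hxe,
    fun hi => hx'.2 (hT.interior_elt_subset he hi)⟩

theorem volume_frontier : volume (frontier Ω) = 0 := by
  refine measure_mono_null hT.frontier_subset ?_
  exact (measure_biUnion_null_iff T.countable_toSet).2 fun e _ => volume_frontier_elt e

theorem closure_ae_eq : closure Ω =ᵐ[volume] Ω := by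
  rw [closure_eq_self_union_frontier]
  exact union_ae_eq_left_of_ae_eq_empty (ae_eq_empty.2 hT.volume_frontier)

theorem aedisjoint {e e' : Finset (Vec d)} (he : e ∈ T) (he' : e' ∈ T) (hne : e ≠ e') :
    AEDisjoint volume (elt e) (elt e') := by
  classical
  unfold AEDisjoint
  rw [hT.inter_eq e he e' he', ← Finset.coe_inter]
  refine volume_convexHull_of_card_le ?_
  have h1 := hT.card_eq e he
  by_contra! hlt
  have h2 : e ∩ e' = e := Finset.eq_of_subset_of_card_le Finset.inter_subset_left (by omega)
  have h3 : e ⊆ e' := h2 ▸ Finset.inter_subset_right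
  exact hne (Finset.eq_of_subset_of_card_le h3 (by rw [h1, hT.card_eq e' he']))

theorem restrict_eq_sum :
    volume.restrict Ω = ∑ e ∈ T, volume.restrict (elt e) := by
  rw [← Measure.restrict_congr_set hT.closure_ae_eq, hT.closure_eq]
  have h := Measure.restrict_iUnion_ae (μ := volume) (s := fun e : T => elt (e : Finset (Vec d)))
    (fun e e' hne => hT.aedisjoint e.2 e'.2 fun h => hne (Subtype.ext h))
    (fun e => (measurableSet_elt _).nullMeasurableSet)
  rw [Set.iUnion_subtype] at h
  rw [h, Measure.sum_fintype]
  exact Finset.sum_coe_sort T fun e => volume.restrict (elt e)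

theorem isFiniteMeasure : IsFiniteMeasure (volume.restrict Ω) :=
  ⟨by simpa using (measure_mono subset_closure).trans_lt hT.isCompact_closure.measure_lt_top⟩

/-- Almost every point of the domain is interior to an element. -/
theorem ae_mem_interior : ∀ᵐ x ∂volume.restrict Ω, ∃ e ∈ T, x ∈ interior (elt e) := by
  rw [hT.restrict_eq_sum, ← Measure.sum_coe_finset]
  refine Measure.ae_sum_iff.2 fun e => ?_
  filter_upwards [ae_mem_interior_elt e.1] with x hx
  exact ⟨e.1, e.2, hx⟩

theorem integral_eq_sum {F : Vec d → ℝ} (hF : IntegrableOn F Ω) :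
    ∫ x in Ω, F x = ∑ e ∈ T, ∫ x in elt e, F x := by
  have hF' : ∀ e ∈ T, IntegrableOn F (elt e) := fun e he =>
    (hF.congr_set_ae hT.closure_ae_eq).mono_set (hT.elt_subset he)
  rw [hT.restrict_eq_sum, integral_finsetSum_measure hF']

theorem eltSize_pos (hd : d ≠ 0) {e : Finset (Vec d)} (he : e ∈ T) : 0 < eltSize e := by
  refine Metric.diam_pos ?_ (isCompact_elt e).isBounded
  have : 1 < e.card := by have := hT.card_eq e he; omega
  obtain ⟨a, ha, b, hb, hab⟩ := Finset.one_lt_card.1 this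
  exact ⟨a, subset_convexHull ℝ _ ha, b, subset_convexHull ℝ _ hb, hab⟩

theorem meshSize_pos (hd : d ≠ 0) : 0 < meshSize T := by
  obtain ⟨e, he⟩ := hT.nonempty
  exact (hT.eltSize_pos hd he).trans_le
    (le_ciSup (f := fun e : T => eltSize (e : Finset (Vec d))) (Set.finite_range _).bddAbove
      ⟨e, he⟩)

end IsTriangulation

/-! ### The size of an element face -/

/-- The convex hull of `n + 1` points at mutual distance at most `h` is contained in the image of
the unit cube of `ℝⁿ` under an affine map with Lipschitz constant `n h`. -/
theorem hausdorffMeasure_convexHull_le {n : ℕ} {s : Finset (Vec d)} (hs : s.card = n + 1)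
    {h : NNReal} (hdist : ∀ p ∈ s, ∀ q ∈ s, dist p q ≤ h) :
    μH[n] (convexHull ℝ (s : Set (Vec d))) ≤ ((n * h : NNReal) : ℝ≥0∞) ^ n := by
  classical
  obtain ⟨p, hp⟩ : s.Nonempty := Finset.card_pos.1 (by omega)
  let ι := {q // q ∈ s.erase p}
  have hcard : Fintype.card ι = n := by simp [ι, hp, hs]
  -- For the supremum norm on `ℝⁿ` the Hausdorff measure is the Lebesgue measure.
  let φ : (ι → ℝ) → Vec d := fun t => p + ∑ i, t i • ((i : Vec d) - p)
  have hφ : LipschitzWith (n * h) φ := by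
    refine LipschitzWith.of_dist_le_mul fun t r => ?_
    have h1 : φ t - φ r = ∑ i, (t i - r i) • ((i : Vec d) - p) := by
      simp [φ, sub_smul]
    rw [dist_eq_norm, h1, dist_eq_norm]
    refine (norm_sum_le _ _).trans ?_
    refine (Finset.sum_le_sum (g := fun _ => (h : ℝ) * ‖t - r‖) fun i _ => ?_).trans (le_of_eq ?_)
    · rw [norm_smul, mul_comm]
      refine mul_le_mul ?_ (norm_le_pi_norm (t - r) i) (norm_nonneg _) h.2
      rw [← dist_eq_norm]
      exact hdist _ (Finset.mem_of_mem_erase i.2) _ hp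
    · rw [Finset.sum_const, Finset.card_univ, hcard]
      simp [mul_assoc]
  have hsub : convexHull ℝ (s : Set (Vec d)) ⊆ φ '' Set.Icc 0 1 := by
    intro x hx
    rw [Finset.mem_convexHull'] at hx
    obtain ⟨w, hw0, hw1, rfl⟩ := hx
    refine ⟨fun i => w i, ⟨fun i => hw0 _ (Finset.mem_of_mem_erase i.2), fun i => ?_⟩, ?_⟩
    · rw [Pi.one_apply, ← hw1]
      exact Finset.single_le_sum hw0 (Finset.mem_of_mem_erase i.2)
    · change p + ∑ i : ι, w i • ((i : Vec d) - p) = _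
      rw [Finset.sum_coe_sort (s.erase p) (fun q => w q • (q - p))]
      rw [← Finset.add_sum_erase s _ hp] at hw1 ⊢
      simp only [smul_sub, Finset.sum_sub_distrib, ← Finset.sum_smul]
      have : w p = 1 - ∑ x ∈ s.erase p, w x := by linarith
      rw [this, sub_smul, one_smul]
      abel
  have hvol : μH[(n : ℝ)] (Set.Icc (0 : ι → ℝ) 1) = 1 := by
    have := hausdorffMeasure_pi_real (ι := ι)
    rw [hcard] at this
    rw [this, Real.volume_Icc_pi]
    simp
  calc μH[n] (convexHull ℝ (s : Set (Vec d))) ≤ μH[n] (φ '' Set.Icc 0 1) := measure_mono hsub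
    _ ≤ ((n * h : NNReal) : ℝ≥0∞) ^ (n : ℝ) * μH[n] (Set.Icc (0 : ι → ℝ) 1) :=
      hφ.lipschitzOnWith.hausdorffMeasure_image_le n.cast_nonneg
    _ = _ := by rw [hvol, mul_one, ENNReal.rpow_natCast]

/-- An element face has area at most `C hᵈ⁻¹`. -/
theorem exists_measure_face_le (hd : d ≠ 0) : ∃ C : NNReal, ∀ e : Finset (Vec d), e.card = d + 1 →
    ∀ a ∈ e, μHE[d - 1] (elt (face e a)) ≤ ENNReal.ofReal (C * eltSize e ^ (d - 1)) := by
  classical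
  refine ⟨Measure.addHaarScalarFactor (volume : Measure (EuclideanSpace ℝ (Fin (d - 1))))
    μH[(d - 1 : ℕ)] * (d - 1 : ℕ) ^ (d - 1), fun e he a ha => ?_⟩
  have hcard : (face e a).card = (d - 1) + 1 := by
    unfold face
    rw [Finset.card_erase_of_mem ha]; omega
  have h0 : 0 ≤ eltSize e := Metric.diam_nonneg
  lift eltSize e to NNReal using h0 with η hη
  have h1 := hausdorffMeasure_convexHull_le hcard (h := η) fun p hp q hq =>
    hη ▸ Metric.dist_le_diam_of_mem (isCompact_elt e).isBounded
      (elt_face_subset e a (subset_convexHull ℝ _ hp))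
      (elt_face_subset e a (subset_convexHull ℝ _ hq))
  rw [Measure.euclideanHausdorffMeasure_def, Measure.smul_apply]
  refine (mul_le_mul_right h1 _).trans (le_of_eq ?_)
  rw [← NNReal.coe_pow, ← NNReal.coe_mul, ENNReal.ofReal_coe_nnreal]
  push_cast
  rw [mul_pow, mul_assoc]

theorem measure_face_lt_top (hd : d ≠ 0) {e : Finset (Vec d)} (he : e.card = d + 1) {a : Vec d}
    (ha : a ∈ e) : μHE[d - 1] (elt (face e a)) < ⊤ := by
  obtain ⟨C, hC⟩ := exists_measure_face_le hd
  exact (hC e he a ha).trans_lt ENNReal.ofReal_lt_top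

theorem norm_outerNormal_le (e : Finset (Vec d)) (a : Vec d) : ‖outerNormal e a‖ ≤ 1 := by
  unfold outerNormal
  rw [norm_smul, norm_inv, norm_norm]
  exact inv_mul_le_one

/-! ### Derivatives of discrete functions -/

theorem gradient_apply (f : Vec d → ℝ) (x : Vec d) (i : Fin d) :
    gradient f x i = fderiv ℝ f x (EuclideanSpace.single i 1) := by
  rw [← toDual_gradient, InnerProductSpace.toDual_apply_apply, EuclideanSpace.inner_single_right]
  simp

theorem gradientWithin_apply (f : Vec d → ℝ) (s : Set (Vec d)) (x : Vec d) (i : Fin d) :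
    gradientWithin f s x i = fderivWithin ℝ f s x (EuclideanSpace.single i 1) := by
  rw [← toDual_gradientWithin, InnerProductSpace.toDual_apply_apply,
    EuclideanSpace.inner_single_right]
  simp

theorem grad_apply {u : Vec d → Vec d} {x : Vec d} (hu : DifferentiableAt ℝ u x) (i j : Fin d) :
    grad u x i j = fderiv ℝ (fun y => u y i) x (EuclideanSpace.single j 1) := by
  have h : HasFDerivAt (fun y => u y i) ((EuclideanSpace.proj (𝕜 := ℝ) i).comp (fderiv ℝ u x)) x :=
    (EuclideanSpace.proj (𝕜 := ℝ) i).hasFDerivAt.comp x hu.hasFDerivAt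
  rw [h.fderiv]; rfl

theorem jac_fderivWithin_apply {u : Vec d → Vec d} {s : Set (Vec d)} {x : Vec d}
    (hu : DifferentiableWithinAt ℝ u s x) (hs : UniqueDiffWithinAt ℝ s x) (i j : Fin d) :
    jac (fderivWithin ℝ u s x) i j =
      fderivWithin ℝ (fun y => u y i) s x (EuclideanSpace.single j 1) := by
  have h : HasFDerivWithinAt (fun y => u y i)
      ((EuclideanSpace.proj (𝕜 := ℝ) i).comp (fderivWithin ℝ u s x)) s x :=
    (EuclideanSpace.proj (𝕜 := ℝ) i).hasFDerivAt.comp_hasFDerivWithinAt x hu.hasFDerivWithinAt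
  rw [h.fderivWithin hs]; rfl

theorem jac_add (L M : Vec d →L[ℝ] Vec d) : jac (L + M) = jac L + jac M := by
  ext i j; simp [jac]

theorem jac_smul (a : ℝ) (L : Vec d →L[ℝ] Vec d) : jac (a • L) = a • jac L := by
  ext i j; simp [jac]

/-- On each element a discrete function is a polynomial `P`, and its gradient, one-sided on the
element boundary, is that of `P`. -/
theorem exists_poly {Ω : Set (Vec d)} {T : Finset (Finset (Vec d))} {k : ℕ} {q : Vec d → ℝ}
    (hT : IsTriangulation Ω T) (hq : q ∈ PwPoly Ω T k) {e : Finset (Vec d)} (he : e ∈ T) :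
    ∃ P : MvPolynomial (Fin d) ℝ, P.totalDegree ≤ k ∧ (∀ x ∈ elt e, q x = evalPoly P x) ∧
      (∀ x ∈ interior (elt e), DifferentiableAt ℝ q x ∧
        ∀ i, gradient q x i = evalPoly (MvPolynomial.pderiv i P) x) ∧
      ∀ x ∈ elt e, DifferentiableWithinAt ℝ q (elt e) x ∧
        ∀ i, gradientWithin q (elt e) x i = evalPoly (MvPolynomial.pderiv i P) x := by
  obtain ⟨P, hP, hPe⟩ := hq.2.2 e he
  have hPe' : ∀ x ∈ elt e, q x = evalPoly P x := hPe
  refine ⟨P, hP, hPe', fun x hx => ?_, fun x hx => ?_⟩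
  · have hev : q =ᶠ[nhds x] evalPoly P :=
      Filter.eventuallyEq_of_mem (mem_interior_iff_mem_nhds.1 hx) hPe'
    refine ⟨(hasFDerivAt_evalPoly P x).differentiableAt.congr_of_eventuallyEq hev, fun i => ?_⟩
    rw [gradient_apply, hev.fderiv_eq, fderiv_evalPoly_single]
  · have hd := (hasFDerivAt_evalPoly P x).differentiableAt
    refine ⟨hd.differentiableWithinAt.congr hPe' (hPe' x hx), fun i => ?_⟩
    rw [gradientWithin_apply, fderivWithin_congr hPe' (hPe' x hx),
      hd.fderivWithin (hT.uniqueDiffOn_elt he x hx), fderiv_evalPoly_single]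

theorem exists_poly_velocity {Ω : Set (Vec d)} {T : Finset (Finset (Vec d))} {k : ℕ}
    {v : Vec d → Vec d} (hT : IsTriangulation Ω T) (hv : v ∈ velocitySpace Ω T k)
    {e : Finset (Vec d)} (he : e ∈ T) :
    ∃ P : Fin d → MvPolynomial (Fin d) ℝ, (∀ i, (P i).totalDegree ≤ k) ∧
      (∀ x ∈ elt e, ∀ i, v x i = evalPoly (P i) x) ∧
      (∀ x ∈ interior (elt e), DifferentiableAt ℝ v x ∧
        ∀ i j, grad v x i j = evalPoly (MvPolynomial.pderiv j (P i)) x) ∧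
      ∀ x ∈ elt e, DifferentiableWithinAt ℝ v (elt e) x ∧
        ∀ i j, jac (fderivWithin ℝ v (elt e) x) i j =
          evalPoly (MvPolynomial.pderiv j (P i)) x := by
  choose P hP h1 h2 h3 using fun i => exists_poly hT (hv.1 i) he
  refine ⟨P, hP, fun x hx i => h1 i x hx, fun x hx => ?_, fun x hx => ?_⟩
  · have hd : DifferentiableAt ℝ v x := differentiableAt_euclidean.2 fun i => (h2 i x hx).1
    refine ⟨hd, fun i j => ?_⟩
    rw [grad_apply hd, ← gradient_apply, (h2 i x hx).2]
  · have hd : DifferentiableWithinAt ℝ v (elt e) x :=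
      differentiableWithinAt_euclidean.2 fun i => (h3 i x hx).1
    refine ⟨hd, fun i j => ?_⟩
    rw [jac_fderivWithin_apply hd (hT.uniqueDiffOn_elt he x hx), ← gradientWithin_apply,
      (h3 i x hx).2]

section
variable {Ω : Set (Vec d)} {T : Finset (Finset (Vec d))} {k : ℕ} (hT : IsTriangulation Ω T)
include hT

/-- A measurable function that agrees with a polynomial in the interior of each element is
essentially bounded. -/
theorem memLp_top_of_piecewise {F : Vec d → ℝ} (hF : AEStronglyMeasurable F (volume.restrict Ω))
    (h : ∀ e ∈ T, ∃ P : MvPolynomial (Fin d) ℝ, ∀ x ∈ interior (elt e), F x = evalPoly P x) :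
    MemLp F ⊤ (volume.restrict Ω) := by
  have h' : ∀ e ∈ T, ∃ C : ℝ, ∀ x ∈ interior (elt e), ‖F x‖ ≤ C := fun e he => by
    obtain ⟨P, hP⟩ := h e he
    obtain ⟨C, hC⟩ := (isCompact_elt e).exists_bound_of_continuousOn
      (continuous_evalPoly P).continuousOn
    exact ⟨C, fun x hx => hP x hx ▸ hC x (interior_subset hx)⟩
  choose! C hC using h'
  refine memLp_top_of_bound hF (∑ e ∈ T, |C e|) ?_
  filter_upwards [hT.ae_mem_interior] with x ⟨e, he, hx⟩
  exact (hC e he x hx).trans ((le_abs_self _).trans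
    (Finset.single_le_sum (f := fun e => |C e|) (fun _ _ => abs_nonneg _) he))

theorem memLp_top_pwPoly {q : Vec d → ℝ} (hq : q ∈ PwPoly Ω T k) :
    MemLp q ⊤ (volume.restrict Ω) := by
  refine memLp_top_of_piecewise hT
    ((hq.1.mono subset_closure).aemeasurable hT.isOpen.measurableSet).aestronglyMeasurable
    fun e he => ?_
  obtain ⟨P, -, h, -⟩ := exists_poly hT hq he
  exact ⟨P, fun x hx => h x (interior_subset hx)⟩

theorem memLp_top_gradient {q : Vec d → ℝ} (hq : q ∈ PwPoly Ω T k) (i : Fin d) :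
    MemLp (fun x => gradient q x i) ⊤ (volume.restrict Ω) := by
  refine memLp_top_of_piecewise hT ?_ fun e he => ?_
  · simp only [gradient_apply]
    exact (measurable_fderiv_apply_const ℝ q _).aestronglyMeasurable
  · obtain ⟨P, -, -, h, -⟩ := exists_poly hT hq he
    exact ⟨_, fun x hx => (h x hx).2 i⟩

theorem memLp_top_velocity {v : Vec d → Vec d} (hv : v ∈ velocitySpace Ω T k) (i : Fin d) :
    MemLp (fun x => v x i) ⊤ (volume.restrict Ω) := memLp_top_pwPoly hT (hv.1 i)

theorem memLp_top_grad {v : Vec d → Vec d} (hv : v ∈ velocitySpace Ω T k) (i j : Fin d) :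
    MemLp (fun x => grad v x i j) ⊤ (volume.restrict Ω) := by
  refine memLp_top_of_piecewise hT ?_ fun e he => ?_
  · have h : Measurable fun x => fderiv ℝ v x (EuclideanSpace.single j 1) :=
      measurable_fderiv_apply_const ℝ v _
    have h' : Measurable fun x => fderiv ℝ v x (EuclideanSpace.single j 1) i :=
      (EuclideanSpace.proj (𝕜 := ℝ) i).continuous.measurable.comp h
    exact h'.aestronglyMeasurable
  · obtain ⟨P, -, -, h, -⟩ := exists_poly_velocity hT hv he
    exact ⟨_, fun x hx => (h x hx).2 i j⟩

theorem ae_differentiableAt_pwPoly {q : Vec d → ℝ} (hq : q ∈ PwPoly Ω T k) :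
    ∀ᵐ x ∂volume.restrict Ω, DifferentiableAt ℝ q x := by
  filter_upwards [hT.ae_mem_interior] with x ⟨e, he, hx⟩
  obtain ⟨P, -, -, h, -⟩ := exists_poly hT hq he
  exact (h x hx).1

theorem ae_differentiableAt_velocity {v : Vec d → Vec d} (hv : v ∈ velocitySpace Ω T k) :
    ∀ᵐ x ∂volume.restrict Ω, DifferentiableAt ℝ v x := by
  filter_upwards [hT.ae_mem_interior] with x ⟨e, he, hx⟩
  obtain ⟨P, -, -, h, -⟩ := exists_poly_velocity hT hv he
  exact (h x hx).1

end

/-! ### The discrete spaces as finite-dimensional vector spaces -/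

theorem pwPoly_smul_add {Ω : Set (Vec d)} {T : Finset (Finset (Vec d))} {k : ℕ} {p q : Vec d → ℝ}
    (hp : p ∈ PwPoly Ω T k) (hq : q ∈ PwPoly Ω T k) (a : ℝ) : a • p + q ∈ PwPoly Ω T k := by
  refine ⟨(hp.1.const_smul a).add hq.1, fun x hx => by simp [hp.2.1 x hx, hq.2.1 x hx],
    fun e he => ?_⟩
  obtain ⟨P, hP, h⟩ := hp.2.2 e he
  obtain ⟨R, hR, h'⟩ := hq.2.2 e he
  refine ⟨a • P + R, (MvPolynomial.totalDegree_add _ _).trans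
    (max_le ((MvPolynomial.totalDegree_smul_le _ _).trans hP) hR), fun x hx => ?_⟩
  simp [h x hx, h' x hx, MvPolynomial.smul_eval]

theorem zero_mem_pwPoly (Ω : Set (Vec d)) (T : Finset (Finset (Vec d))) (k : ℕ) :
    0 ∈ PwPoly Ω T k :=
  ⟨continuousOn_const, fun _ _ => rfl, fun _ _ => ⟨0, by simp, fun x _ => by simp⟩⟩

/-- `PwPoly` as a vector space. -/
def pwPolySubmodule (Ω : Set (Vec d)) (T : Finset (Finset (Vec d))) (k : ℕ) :
    Submodule ℝ (Vec d → ℝ) where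
  carrier := PwPoly Ω T k
  add_mem' {p q} hp hq := by simpa using pwPoly_smul_add hp hq 1
  zero_mem' := zero_mem_pwPoly Ω T k
  smul_mem' a p hp := by simpa using pwPoly_smul_add hp (zero_mem_pwPoly Ω T k) a

/-- The velocity space `X_h` as a vector space. -/
def velocitySubmodule (Ω : Set (Vec d)) (T : Finset (Finset (Vec d))) (k : ℕ) :
    Submodule ℝ (Vec d → Vec d) where
  carrier := velocitySpace Ω T k
  add_mem' {u v} hu hv := ⟨fun i => (pwPolySubmodule Ω T k).add_mem (hu.1 i) (hv.1 i),
    fun x hx => by simp [hu.2 x hx, hv.2 x hx]⟩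
  zero_mem' := ⟨fun _ => zero_mem_pwPoly Ω T k, fun _ _ => rfl⟩
  smul_mem' a u hu := ⟨fun i => (pwPolySubmodule Ω T k).smul_mem a (hu.1 i),
    fun x hx => by simp [hu.2 x hx]⟩

theorem finiteDimensional_pwPolySubmodule {Ω : Set (Vec d)} {T : Finset (Finset (Vec d))}
    (hT : IsTriangulation Ω T) (k : ℕ) : FiniteDimensional ℝ (pwPolySubmodule Ω T k) := by
  -- A discrete function is determined by its restrictions to the elements, each of which lies in
  -- the finite-dimensional image of the polynomials of degree at most `k`.
  let R (e : T) : MvPolynomial.restrictTotalDegree (Fin d) ℝ k →ₗ[ℝ] (elt e.1 → ℝ) :=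
    { toFun := fun P x => evalPoly P.1 x
      map_add' := fun P P' => by ext x; simp [evalPoly]
      map_smul' := fun a P => by ext x; simp [evalPoly, MvPolynomial.smul_eval] }
  have hR (q : pwPolySubmodule Ω T k) (e : T) :
      (fun x : elt e.1 => q.1 x) ∈ LinearMap.range (R e) := by
    obtain ⟨P, hP, h⟩ := q.2.2.2 e.1 e.2
    exact ⟨⟨P, (MvPolynomial.mem_restrictTotalDegree _ _ _).2 hP⟩, funext fun x => (h x x.2).symm⟩
  let Φ : pwPolySubmodule Ω T k →ₗ[ℝ] ((e : T) → LinearMap.range (R e)) :=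
    { toFun := fun q e => ⟨_, hR q e⟩
      map_add' := fun _ _ => rfl
      map_smul' := fun _ _ => rfl }
  refine FiniteDimensional.of_injective Φ fun p q hpq => Subtype.ext (funext fun x => ?_)
  by_cases hx : x ∈ closure Ω
  · rw [hT.closure_eq, Set.mem_iUnion₂] at hx
    obtain ⟨e, he, hxe⟩ := hx
    exact congrFun (congrArg Subtype.val (congrFun hpq ⟨e, he⟩)) ⟨x, hxe⟩
  · rw [p.2.2.1 x hx, q.2.2.1 x hx]

theorem finiteDimensional_velocitySubmodule {Ω : Set (Vec d)} {T : Finset (Finset (Vec d))}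
    (hT : IsTriangulation Ω T) (k : ℕ) : FiniteDimensional ℝ (velocitySubmodule Ω T k) := by
  have := finiteDimensional_pwPolySubmodule hT k
  let Φ : velocitySubmodule Ω T k →ₗ[ℝ] (Fin d → pwPolySubmodule Ω T k) :=
    { toFun := fun v i => ⟨_, v.2.1 i⟩
      map_add' := fun _ _ => rfl
      map_smul' := fun _ _ => rfl }
  refine FiniteDimensional.of_injective Φ fun u v huv => Subtype.ext (funext fun x => ?_)
  ext i
  exact congrFun (congrArg Subtype.val (congrFun huv i)) x

theorem integrable_pwPoly {Ω : Set (Vec d)} {T : Finset (Finset (Vec d))} {k : ℕ}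
    (hT : IsTriangulation Ω T) {q : Vec d → ℝ} (hq : q ∈ PwPoly Ω T k) :
    Integrable q (volume.restrict Ω) := by
  have := hT.isFiniteMeasure
  exact (memLp_top_pwPoly hT hq).integrable le_top

/-- The pressure space `Y_h` as a subspace of the space of all discrete functions. -/
def pressureSubmodule {Ω : Set (Vec d)} {T : Finset (Finset (Vec d))} (hT : IsTriangulation Ω T)
    (l : ℕ) : Submodule ℝ (pwPolySubmodule Ω T l) where
  carrier := {q | ∫ x in Ω, q.1 x = 0}
  add_mem' {p q} hp hq := by
    have hp' : ∫ x in Ω, p.1 x = 0 := hp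
    have hq' : ∫ x in Ω, q.1 x = 0 := hq
    change ∫ x in Ω, (p.1 x + q.1 x) = 0
    rw [integral_add (integrable_pwPoly hT p.2) (integrable_pwPoly hT q.2), hp', hq', add_zero]
  zero_mem' := by simp
  smul_mem' a p hp := by
    have hp' : ∫ x in Ω, p.1 x = 0 := hp
    change ∫ x in Ω, a * p.1 x = 0
    rw [integral_const_mul, hp', mul_zero]

/-! ### Lipschitz continuity of discrete velocities -/

/-- A continuous function that is Lipschitz on each set of a finite closed cover of a vector space
is Lipschitz: along a segment, every point is approached from the right within one of the sets, which
bounds the lower right Dini derivative. -/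
theorem lipschitzWith_of_finite_closed_cover {E ι : Type*} [NormedAddCommGroup E] [NormedSpace ℝ E]
    [Finite ι] {f : E → ℝ} (hf : Continuous f) {L : NNReal} {K : ι → Set E}
    (hK : ∀ i, IsClosed (K i)) (hcov : ∀ x, ∃ i, x ∈ K i) (hL : ∀ i, LipschitzOnWith L f (K i)) :
    LipschitzWith L f := by
  refine LipschitzWith.of_le_add_mul L fun x y => ?_
  let γ : ℝ → E := fun t => y + t • (x - y)
  have hγ : Continuous γ := by fun_prop
  have hγd (s t : ℝ) : dist (γ s) (γ t) = |s - t| * dist x y := by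
    have h : γ s - γ t = (s - t) • (x - y) := by simp [γ, sub_smul]
    rw [dist_eq_norm, dist_eq_norm, h, norm_smul, Real.norm_eq_abs]
  have key := image_le_of_liminf_slope_right_le_deriv_boundary (f := f ∘ γ) (a := 0) (b := 1)
    (B := fun t => f y + t * (L * dist x y)) (B' := fun _ => L * dist x y)
    (hf.comp hγ).continuousOn (by simp [γ]) (by fun_prop)
    (fun t _ => by
      simpa using (((hasDerivAt_id t).mul_const (L * dist x y)).const_add (f y)).hasDerivWithinAt)
    (fun t _ r hr => by
      have hfreq : ∃ᶠ s in nhdsWithin t (Set.Ioi t), ∃ i, γ s ∈ K i :=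
        (Filter.Eventually.of_forall fun s => hcov (γ s)).frequently
      obtain ⟨i, hi⟩ := Filter.frequently_exists.1 hfreq
      have hti : γ t ∈ K i := ((hK i).preimage hγ).mem_of_frequently_of_tendsto hi
        (Filter.tendsto_id'.2 nhdsWithin_le_nhds)
      refine (hi.and_eventually self_mem_nhdsWithin).mono fun s ⟨hs, hst⟩ => ?_
      have hst' : 0 < s - t := sub_pos.2 hst
      refine lt_of_le_of_lt ?_ hr
      rw [slope_def_field, div_le_iff₀ hst']
      have := (hL i).dist_le_mul _ hs _ hti
      rw [hγd, abs_of_pos hst', Real.dist_eq] at this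
      calc (f ∘ γ) s - (f ∘ γ) t ≤ |f (γ s) - f (γ t)| := le_abs_self _
        _ ≤ _ := this
        _ = _ := by ring)
  have := key (Set.right_mem_Icc.2 zero_le_one)
  simpa [γ] using this

theorem exists_lipschitzOnWith_evalPoly (P : MvPolynomial (Fin d) ℝ) (e : Finset (Vec d)) :
    ∃ L : NNReal, LipschitzOnWith L (evalPoly P) (elt e) := by
  have hc : Continuous fun x => fderiv ℝ (evalPoly P) x := by
    simp only [fun x => (hasFDerivAt_evalPoly P x).fderiv]
    exact continuous_finsetSum _ fun i _ => (continuous_evalPoly _).smul continuous_const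
  obtain ⟨C, hC⟩ := (isCompact_elt e).exists_bound_of_continuousOn hc.continuousOn
  refine ⟨C.toNNReal, (convex_elt e).lipschitzOnWith_of_nnnorm_fderiv_le
    (fun x _ => (hasFDerivAt_evalPoly P x).differentiableAt) fun x hx => ?_⟩
  rw [← NNReal.coe_le_coe, coe_nnnorm]
  exact (hC x hx).trans (Real.le_coe_toNNReal C)

theorem velocity_eq_zero_of_notMem {Ω : Set (Vec d)} {T : Finset (Finset (Vec d))} {k : ℕ}
    {v : Vec d → Vec d} (hT : IsTriangulation Ω T) (hv : v ∈ velocitySpace Ω T k) {x : Vec d}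
    (hx : x ∉ Ω) : v x = 0 := by
  by_cases hc : x ∈ closure Ω
  · refine hv.2 x ?_
    rw [frontier, hT.isOpen.interior_eq]
    exact ⟨hc, hx⟩
  · ext i
    exact (hv.1 i).2.1 x hc

theorem exists_lipschitzWith_velocity {Ω : Set (Vec d)} {T : Finset (Finset (Vec d))} {k : ℕ}
    {v : Vec d → Vec d} (hT : IsTriangulation Ω T) (hv : v ∈ velocitySpace Ω T k) (i : Fin d) :
    ∃ L : NNReal, LipschitzWith L fun x => v x i := by
  have h0 : ∀ x ∈ Ωᶜ, v x i = 0 := fun x hx => by simp [velocity_eq_zero_of_notMem hT hv hx]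
  have hcont : Continuous fun x => v x i := by
    have h1 : ContinuousOn (fun x => v x i) Ωᶜ := continuousOn_const.congr h0
    have h2 := (hv.1 i).1.union_of_isClosed h1 isClosed_closure hT.isOpen.isClosed_compl
    rwa [Set.eq_univ_of_univ_subset ((Set.union_compl_self Ω).symm.subset.trans
      (Set.union_subset_union_left _ subset_closure)), continuousOn_univ] at h2
  have hel : ∀ e : T, ∃ L : NNReal, LipschitzOnWith L (fun x => v x i) (elt e.1) := fun e => by
    obtain ⟨P, -, h, -⟩ := exists_poly hT (hv.1 i) e.2
    obtain ⟨L, hL⟩ := exists_lipschitzOnWith_evalPoly P e.1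
    exact ⟨L, fun x hx y hy => by simpa only [h x hx, h y hy] using hL hx hy⟩
  choose L hL using hel
  -- The closed cover: the elements, and the complement of the domain, where the field vanishes.
  let K : Option T → Set (Vec d) := fun o => o.elim Ωᶜ fun e => elt e.1
  refine ⟨∑ e, L e, lipschitzWith_of_finite_closed_cover (K := K) hcont ?_ ?_ ?_⟩
  · rintro (_ | e)
    · exact hT.isOpen.isClosed_compl
    · exact (isCompact_elt e.1).isClosed
  · intro x
    by_cases hx : x ∈ Ω
    · have := subset_closure hx
      rw [hT.closure_eq, Set.mem_iUnion₂] at this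
      obtain ⟨e, he, hxe⟩ := this
      exact ⟨some ⟨e, he⟩, hxe⟩
    · exact ⟨none, hx⟩
  · rintro (_ | e)
    · exact LipschitzOnWith.of_dist_le_mul fun x hx y hy => by
        rw [h0 x hx, h0 y hy, dist_self]; positivity
    · exact (hL e).weaken (Finset.single_le_sum (f := L) (fun _ _ => bot_le) (Finset.mem_univ e))

/-! ### Korn's inequality -/

section
variable {E : Type*} [NormedAddCommGroup E] [NormedSpace ℝ E]

theorem lineDeriv_eq_zero_of_notMem_tsupport {f : E → ℝ} {x : E} (hx : x ∉ tsupport f) (v : E) :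
    lineDeriv ℝ f x v = 0 := by
  have h : f =ᶠ[nhds x] fun _ => 0 := notMem_tsupport_iff_eventuallyEq.1 hx
  rw [h.lineDeriv_eq]
  simp [lineDeriv]

variable [MeasurableSpace E] [BorelSpace E] {μ : Measure E}

theorem integrable_lineDeriv [IsFiniteMeasureOnCompacts μ] {f : E → ℝ} {C : NNReal}
    (hf : LipschitzWith C f) (hfc : HasCompactSupport f) (v : E) :
    Integrable (fun x => lineDeriv ℝ f x v) μ := by
  rw [← integrableOn_iff_integrable_of_support_subset (s := tsupport f)
    (fun x hx => by_contra fun h => hx (lineDeriv_eq_zero_of_notMem_tsupport h v))]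
  have : IsFiniteMeasure (μ.restrict (tsupport f)) := ⟨by simpa using hfc.isCompact.measure_lt_top⟩
  exact (hf.memLp_lineDeriv v).integrable le_top

/-- For compactly supported Lipschitz functions the directions of the derivatives may be
interchanged under the integral.  One derivative is a limit of difference quotients; for these, the
other derivative can be moved from `f` to `g`, and the difference quotient back to `f`. -/
theorem integral_lineDeriv_mul_lineDeriv_comm [FiniteDimensional ℝ E] [μ.IsAddHaarMeasure]
    {f g : E → ℝ} {C D : NNReal}
    (hf : LipschitzWith C f) (hfc : HasCompactSupport f) (hg : LipschitzWith D g)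
    (hgc : HasCompactSupport g) (v w : E) :
    ∫ x, lineDeriv ℝ f x v * lineDeriv ℝ g x w ∂μ =
      ∫ x, lineDeriv ℝ f x w * lineDeriv ℝ g x v ∂μ := by
  have hA := hg.integral_inv_smul_sub_mul_tendsto_integral_lineDeriv_mul
    (integrable_lineDeriv (μ := μ) hf hfc v) w
  have hB := hf.integral_inv_smul_sub_mul_tendsto_integral_lineDeriv_mul
    (integrable_lineDeriv (μ := μ) hg hgc (-v)) (-w)
  -- Integration by parts turns the first difference quotient into one of `g`'s derivative, which a
  -- translation of the variable moves onto `f`.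
  have hswap : ∀ t : ℝ, ∫ x, (t⁻¹ • (g (x + t • w) - g x)) * lineDeriv ℝ f x v ∂μ =
      ∫ x, (t⁻¹ • (f (x + t • (-w)) - f x)) * lineDeriv ℝ g x (-v) ∂μ := by
    intro t
    have htr : LipschitzWith D fun x => g (x + t • w) :=
      LipschitzWith.of_dist_le_mul fun x y => by
        simpa using hg.dist_le_mul (x + t • w) (y + t • w)
    have hq : LipschitzWith (‖t⁻¹‖₊ * (D + D)) fun x => t⁻¹ • (g (x + t • w) - g x) :=
      (lipschitzWith_smul t⁻¹).comp (htr.sub hg)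
    have htc : HasCompactSupport fun x => g (x + t • w) :=
      hgc.comp_homeomorph (Homeomorph.addRight (t • w))
    have hqc : HasCompactSupport fun x => t⁻¹ • (g (x + t • w) - g x) :=
      HasCompactSupport.comp_left (g := fun r : ℝ => t⁻¹ • r) (htc.sub hgc) (by simp)
    have hfi : Integrable f μ := hf.continuous.integrable_of_hasCompactSupport hfc
    have hm : Measurable fun x => lineDeriv ℝ g x (-v) := measurable_lineDeriv hg.continuous
    have hbd : ∀ x, ‖lineDeriv ℝ g x (-v)‖ ≤ D * ‖-v‖ := fun x =>
      norm_lineDeriv_le_of_lipschitz ℝ hg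
    have hi1 : Integrable (fun x => lineDeriv ℝ g x (-v) * f x) μ :=
      hfi.bdd_mul hm.aestronglyMeasurable (Filter.Eventually.of_forall hbd)
    have hi2 : Integrable (fun x => lineDeriv ℝ g (x + t • w) (-v) * f x) μ :=
      hfi.bdd_mul (hm.comp (measurable_add_const _)).aestronglyMeasurable
        (Filter.Eventually.of_forall fun x => hbd _)
    have hi3 : Integrable (fun x => f (x + t • (-w)) * lineDeriv ℝ g x (-v)) μ :=
      (hfi.comp_add_right (t • (-w))).mul_bdd (c := D * ‖-v‖) hm.aestronglyMeasurable
        (Filter.Eventually.of_forall hbd)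
    have hae1 := hg.ae_lineDifferentiableAt (μ := μ) (-v)
    have hae2 : ∀ᵐ x ∂μ, LineDifferentiableAt ℝ g (x + t • w) (-v) :=
      (measurePreserving_add_right μ (t • w)).quasiMeasurePreserving.ae hae1
    calc ∫ x, (t⁻¹ • (g (x + t • w) - g x)) * lineDeriv ℝ f x v ∂μ
        = ∫ x, lineDeriv ℝ f x v * (t⁻¹ • (g (x + t • w) - g x)) ∂μ := by simp only [mul_comm]
      _ = ∫ x, lineDeriv ℝ (fun x => t⁻¹ • (g (x + t • w) - g x)) x (-v) * f x ∂μ :=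
          hf.integral_lineDeriv_mul_eq hq hqc v
      _ = ∫ x, t⁻¹ * (lineDeriv ℝ g (x + t • w) (-v) * f x - lineDeriv ℝ g x (-v) * f x) ∂μ := by
          refine integral_congr_ae ?_
          filter_upwards [hae1, hae2] with x h1 h2
          have h2' : HasDerivAt (fun s : ℝ => g (x + s • (-v) + t • w))
              (lineDeriv ℝ g (x + t • w) (-v)) 0 := by
            refine HasDerivAt.congr_of_eventuallyEq (HasLineDerivAt.lineDeriv h2.hasLineDerivAt ▸
              h2.hasLineDerivAt) (Filter.Eventually.of_forall fun s => ?_)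
            simp only [add_right_comm]
          have h3 : HasLineDerivAt ℝ (fun x => t⁻¹ • (g (x + t • w) - g x))
              (t⁻¹ • (lineDeriv ℝ g (x + t • w) (-v) - lineDeriv ℝ g x (-v))) x (-v) :=
            (h2'.sub h1.hasLineDerivAt).const_smul t⁻¹
          rw [h3.lineDeriv, smul_eq_mul]
          ring
      _ = t⁻¹ * (∫ x, lineDeriv ℝ g (x + t • w) (-v) * f x ∂μ
            - ∫ x, lineDeriv ℝ g x (-v) * f x ∂μ) := by
          rw [integral_const_mul, integral_sub hi2 hi1]
      _ = t⁻¹ * (∫ x, f (x + t • (-w)) * lineDeriv ℝ g x (-v) ∂μ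
            - ∫ x, f x * lineDeriv ℝ g x (-v) ∂μ) := by
          congr 2
          · rw [← integral_add_right_eq_self _ (t • (-w))]
            simp [mul_comm]
          · simp only [mul_comm]
      _ = ∫ x, t⁻¹ * (f (x + t • (-w)) * lineDeriv ℝ g x (-v)
            - f x * lineDeriv ℝ g x (-v)) ∂μ := by
          rw [integral_const_mul, integral_sub hi3 (by simpa only [mul_comm] using hi1)]
      _ = _ := by
          refine integral_congr_ae (Filter.Eventually.of_forall fun x => ?_)
          simp only [smul_eq_mul]
          ring
  simp only [hswap] at hA
  have := tendsto_nhds_unique hA hB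
  simp only [lineDeriv_neg, neg_mul_neg] at this
  simpa only [mul_comm] using this

end

section
variable {Ω : Set (Vec d)} {T : Finset (Finset (Vec d))} {k : ℕ} {v : Vec d → Vec d}

theorem integral_grad_mul_grad_eq (hT : IsTriangulation Ω T) (hv : v ∈ velocitySpace Ω T k)
    (i j m n : Fin d) : ∫ x in Ω, grad v x i m * grad v x j n =
      ∫ x, lineDeriv ℝ (fun y => v y i) x (EuclideanSpace.single m 1) *
        lineDeriv ℝ (fun y => v y j) x (EuclideanSpace.single n 1) := by
  have h1 : ∫ x in Ω, grad v x i m * grad v x j n =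
      ∫ x in Ω, lineDeriv ℝ (fun y => v y i) x (EuclideanSpace.single m 1) *
        lineDeriv ℝ (fun y => v y j) x (EuclideanSpace.single n 1) := by
    refine integral_congr_ae ?_
    filter_upwards [ae_differentiableAt_velocity hT hv] with x hx
    rw [grad_apply hx, grad_apply hx, (differentiableAt_euclidean.1 hx i).lineDeriv_eq_fderiv,
      (differentiableAt_euclidean.1 hx j).lineDeriv_eq_fderiv]
  rw [h1]
  refine setIntegral_eq_integral_of_ae_compl_eq_zero ?_
  filter_upwards [compl_mem_ae_iff.2 hT.volume_frontier] with x hx hxΩ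
  have hxc : x ∉ closure Ω := fun h => hx ⟨h, by rwa [hT.isOpen.interior_eq]⟩
  have : x ∉ tsupport fun y => v y i := fun h => hxc
    (closure_mono (Function.support_subset_iff'.2 fun y hy => by
      simp [velocity_eq_zero_of_notMem hT hv hy]) h)
  rw [lineDeriv_eq_zero_of_notMem_tsupport this, zero_mul]

/-- `∫ ∂ⱼvᵢ ∂ᵢvⱼ = ∫ ∂ᵢvᵢ ∂ⱼvⱼ`: the field vanishes on the boundary, so that its zero extension has
derivatives zero outside the domain. -/
theorem integral_grad_comm (hT : IsTriangulation Ω T) (hv : v ∈ velocitySpace Ω T k) (i j : Fin d) :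
    ∫ x in Ω, grad v x i j * grad v x j i = ∫ x in Ω, grad v x i i * grad v x j j := by
  have hc (i : Fin d) : HasCompactSupport fun y => v y i :=
    HasCompactSupport.intro hT.isCompact_closure fun x hx => (hv.1 i).2.1 x hx
  obtain ⟨L, hL⟩ := exists_lipschitzWith_velocity hT hv i
  obtain ⟨M, hM⟩ := exists_lipschitzWith_velocity hT hv j
  rw [integral_grad_mul_grad_eq hT hv, integral_grad_mul_grad_eq hT hv,
    integral_lineDeriv_mul_lineDeriv_comm hL (hc i) hM (hc j)]

theorem two_mul_frob_symm (A : Matrix (Fin d) (Fin d) ℝ) :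
    2 * frob ((1 / 2 : ℝ) • (A + Aᵀ)) ((1 / 2 : ℝ) • (A + Aᵀ)) =
      frob A A + ∑ i, ∑ j, A i j * A j i := by
  have h : ∑ i, ∑ j, A j i * A j i = ∑ i, ∑ j, A i j * A i j := Finset.sum_comm
  have h2 : 2 * frob ((1 / 2 : ℝ) • (A + Aᵀ)) ((1 / 2 : ℝ) • (A + Aᵀ)) =
      (1 / 2) * ∑ i, ∑ j, A i j * A i j + ∑ i, ∑ j, A i j * A j i
        + (1 / 2) * ∑ i, ∑ j, A j i * A j i := by
    simp only [frob, Finset.mul_sum, ← Finset.sum_add_distrib, Matrix.smul_apply, Matrix.add_apply,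
      Matrix.transpose_apply, smul_eq_mul]
    exact Finset.sum_congr rfl fun i _ => Finset.sum_congr rfl fun j _ => by ring
  rw [h2, h, frob]
  ring

theorem integrable_mul_of_memLp_top {α : Type*} [MeasurableSpace α] {μ : Measure α}
    [IsFiniteMeasure μ] {f g : α → ℝ} (hf : MemLp f ⊤ μ) (hg : MemLp g ⊤ μ) :
    Integrable (fun x => f x * g x) μ :=
  (hg.mul' hf (r := ⊤)).integrable le_top

theorem integrable_frob_grad {u v : Vec d → Vec d} (hT : IsTriangulation Ω T)
    (hu : u ∈ velocitySpace Ω T k) (hv : v ∈ velocitySpace Ω T k) :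
    Integrable (fun x => frob (grad u x) (grad v x)) (volume.restrict Ω) := by
  have := hT.isFiniteMeasure
  exact integrable_finsetSum _ fun i _ => integrable_finsetSum _ fun j _ =>
    integrable_mul_of_memLp_top (memLp_top_grad hT hu i j) (memLp_top_grad hT hv i j)

/-- Korn's inequality with constant one for fields that vanish on the boundary:
`2 ‖∇ˢv‖² = ‖∇v‖² + ‖∇ · v‖²`. -/
theorem integral_frob_grad_le (hT : IsTriangulation Ω T) (hv : v ∈ velocitySpace Ω T k) :
    ∫ x in Ω, frob (grad v x) (grad v x) ≤ ∫ x in Ω, 2 * frob (symGrad v x) (symGrad v x) := by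
  have := hT.isFiniteMeasure
  have hint (i j m n : Fin d) : Integrable (fun x => grad v x i j * grad v x m n)
      (volume.restrict Ω) :=
    integrable_mul_of_memLp_top (memLp_top_grad hT hv i j) (memLp_top_grad hT hv m n)
  have hcross : 0 ≤ ∫ x in Ω, ∑ i, ∑ j, grad v x i j * grad v x j i := by
    have h1 : ∫ x in Ω, ∑ i, ∑ j, grad v x i j * grad v x j i =
        ∫ x in Ω, (∑ i, grad v x i i) * ∑ j, grad v x j j := by
      simp only [Finset.sum_mul_sum]
      rw [integral_finsetSum _ fun i _ => integrable_finsetSum _ fun j _ => hint i j j i,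
        integral_finsetSum _ fun i _ => integrable_finsetSum _ fun j _ => hint i i j j]
      refine Finset.sum_congr rfl fun i _ => ?_
      rw [integral_finsetSum _ fun j _ => hint i j j i,
        integral_finsetSum _ fun j _ => hint i i j j]
      exact Finset.sum_congr rfl fun j _ => integral_grad_comm hT hv i j
    rw [h1]
    exact integral_nonneg fun x => mul_self_nonneg _
  simp only [symGrad, two_mul_frob_symm]
  rw [integral_add (integrable_frob_grad hT hv hv)
    (integrable_finsetSum _ fun i _ => integrable_finsetSum _ fun j _ => hint i j j i)]
  linarith

end

/-! ### The boundary term -/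

theorem frob_self_nonneg (A : Matrix (Fin d) (Fin d) ℝ) : 0 ≤ frob A A :=
  Finset.sum_nonneg fun _ _ => Finset.sum_nonneg fun _ _ => mul_self_nonneg _

theorem abs_entry_le_sqrt_frob (A : Matrix (Fin d) (Fin d) ℝ) (i j : Fin d) :
    |A i j| ≤ √(frob A A) := by
  refine Real.abs_le_sqrt ?_
  rw [sq]
  exact (Finset.single_le_sum (f := fun j => A i j * A i j) (fun _ _ => mul_self_nonneg _)
    (Finset.mem_univ j)).trans (Finset.single_le_sum (f := fun i => ∑ j, A i j * A i j)
      (fun _ _ => Finset.sum_nonneg fun _ _ => mul_self_nonneg _) (Finset.mem_univ i))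

theorem abs_crossCurl_le (a n : Vec d) (hn : ‖n‖ ≤ 1) (J : Matrix (Fin d) (Fin d) ℝ) :
    |crossCurl a n J| ≤ 2 * (d : ℝ) ^ 2 * (‖a‖ * √(frob J J)) := by
  have ha (i : Fin d) : |a i| ≤ ‖a‖ := PiLp.norm_apply_le a i
  have hn' (i : Fin d) : |n i| ≤ 1 := (PiLp.norm_apply_le n i).trans hn
  have hterm (i j : Fin d) :
      |(a i * n j - a j * n i) * (J j i - J i j)| ≤ 4 * (‖a‖ * √(frob J J)) := by
    have h1 (i j : Fin d) : |a i * n j| ≤ ‖a‖ := by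
      rw [abs_mul]
      simpa using mul_le_mul (ha i) (hn' j) (abs_nonneg _) (norm_nonneg a)
    have h2 : |a i * n j - a j * n i| ≤ 2 * ‖a‖ :=
      (abs_sub _ _).trans (by linarith [h1 i j, h1 j i])
    have h3 : |J j i - J i j| ≤ 2 * √(frob J J) :=
      (abs_sub _ _).trans (by linarith [abs_entry_le_sqrt_frob J i j, abs_entry_le_sqrt_frob J j i])
    rw [abs_mul]
    calc _ ≤ (2 * ‖a‖) * (2 * √(frob J J)) := mul_le_mul h2 h3 (abs_nonneg _) (by positivity)
      _ = _ := by ring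
  have hsum : |∑ i, ∑ j, (a i * n j - a j * n i) * (J j i - J i j)| ≤
      ∑ _i : Fin d, ∑ _j : Fin d, 4 * (‖a‖ * √(frob J J)) :=
    (Finset.abs_sum_le_sum_abs _ _).trans (Finset.sum_le_sum fun i _ =>
      (Finset.abs_sum_le_sum_abs _ _).trans (Finset.sum_le_sum fun j _ => hterm i j))
  simp only [Finset.sum_const, Finset.card_univ, Fintype.card_fin, nsmul_eq_mul] at hsum
  rw [crossCurl, abs_mul, abs_of_pos (by norm_num : (0 : ℝ) < 1 / 2)]
  linarith

/-- The inverse inequality on a shape-regular element, for a finite family of polynomials. -/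
theorem exists_sum_sq_le_integral_elt (ι : Type*) [Fintype ι] (hd : d ≠ 0) (m : ℕ) {κ : ℝ}
    (hκ : 0 < κ) :
    ∃ C : ℝ, 0 < C ∧ ∀ (Ω : Set (Vec d)) (T : Finset (Finset (Vec d))), IsTriangulation Ω T →
      ShapeRegular κ T → ∀ e ∈ T, ∀ P : ι → MvPolynomial (Fin d) ℝ,
      (∀ i, (P i).totalDegree ≤ m) → ∀ x ∈ elt e, ∑ i, evalPoly (P i) x ^ 2 ≤
        C * (eltSize e ^ d)⁻¹ * ∫ y in elt e, ∑ i, evalPoly (P i) y ^ 2 := by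
  obtain ⟨C, hC, hle⟩ := exists_sq_le_integral d m hκ
  refine ⟨C, hC, fun Ω T hT hκT e he P hP x hx => ?_⟩
  have hh := hT.eltSize_pos hd he
  obtain ⟨c, hc⟩ := hκT e he
  have hce : c ∈ elt e := hc (Metric.mem_closedBall_self (by positivity))
  have hint (i : ι) : IntegrableOn (fun y => evalPoly (P i) y ^ 2) (elt e) :=
    ((continuous_evalPoly (P i)).pow 2).continuousOn.integrableOn_compact (isCompact_elt e)
  rw [integral_finsetSum _ fun i _ => hint i, Finset.mul_sum]
  refine Finset.sum_le_sum fun i _ =>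
    (hle c _ hh (P i) (hP i) x (elt_subset_closedBall hce hx)).trans ?_
  refine mul_le_mul_of_nonneg_left ?_ (by positivity)
  exact setIntegral_mono_set (hint i) (Filter.Eventually.of_forall fun _ => sq_nonneg _)
    (Filter.Eventually.of_forall hc)

/-- Pointwise bounds for the one-sided derivatives of discrete functions on a closed element. -/
theorem exists_sq_derivatives_le (hd : d ≠ 0) (k l : ℕ) {κ : ℝ} (hκ : 0 < κ) :
    ∃ C : ℝ, 0 < C ∧ ∀ (Ω : Set (Vec d)) (T : Finset (Finset (Vec d))), IsTriangulation Ω T →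
      ShapeRegular κ T → ∀ e ∈ T, ∀ x ∈ elt e,
      (∀ q ∈ PwPoly Ω T l, ‖gradientWithin q (elt e) x‖ ^ 2 ≤
        C * (eltSize e ^ d)⁻¹ * ∫ y in elt e, ‖gradient q y‖ ^ 2) ∧
      ∀ v ∈ velocitySpace Ω T k,
        frob (jac (fderivWithin ℝ v (elt e) x)) (jac (fderivWithin ℝ v (elt e) x)) ≤
        C * (eltSize e ^ d)⁻¹ * ∫ y in elt e, frob (grad v y) (grad v y) := by
  obtain ⟨C, hC, hle⟩ := exists_sum_sq_le_integral_elt (Fin d) hd l hκ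
  obtain ⟨C', hC', hle'⟩ := exists_sum_sq_le_integral_elt (Fin d × Fin d) hd k hκ
  refine ⟨max C C', lt_max_of_lt_left hC, fun Ω T hT hκT e he x hx =>
    ⟨fun q hq => ?_, fun v hv => ?_⟩⟩
  · have hh := hT.eltSize_pos hd he
    obtain ⟨P, hP, -, hi, hb⟩ := exists_poly hT hq he
    have h1 : ∫ y in elt e, ‖gradient q y‖ ^ 2 =
        ∫ y in elt e, ∑ i, evalPoly (MvPolynomial.pderiv i P) y ^ 2 := by
      refine integral_congr_ae ?_
      filter_upwards [ae_mem_interior_elt e] with y hy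
      rw [EuclideanSpace.real_norm_sq_eq]
      simp only [(hi y hy).2]
    rw [EuclideanSpace.real_norm_sq_eq, h1]
    simp only [(hb x hx).2]
    refine (hle Ω T hT hκT e he _ (fun i => (totalDegree_pderiv_le P i).trans hP) x hx).trans ?_
    have : 0 ≤ ∫ y in elt e, ∑ i, evalPoly (MvPolynomial.pderiv i P) y ^ 2 :=
      integral_nonneg fun y => Finset.sum_nonneg fun _ _ => sq_nonneg _
    gcongr
    exact le_max_left _ _
  · have hh := hT.eltSize_pos hd he
    obtain ⟨P, hP, -, hi, hb⟩ := exists_poly_velocity hT hv he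
    have h1 : ∫ y in elt e, frob (grad v y) (grad v y) = ∫ y in elt e,
        ∑ ij : Fin d × Fin d, evalPoly (MvPolynomial.pderiv ij.2 (P ij.1)) y ^ 2 := by
      refine integral_congr_ae ?_
      filter_upwards [ae_mem_interior_elt e] with y hy
      simp only [frob, (hi y hy).2, Fintype.sum_prod_type, sq]
    rw [h1]
    have h2 := hle' Ω T hT hκT e he (fun ij => MvPolynomial.pderiv ij.2 (P ij.1))
      (fun ij => (totalDegree_pderiv_le _ _).trans (hP _)) x hx
    have : 0 ≤ ∫ y in elt e,
        ∑ ij : Fin d × Fin d, evalPoly (MvPolynomial.pderiv ij.2 (P ij.1)) y ^ 2 :=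
      integral_nonneg fun y => Finset.sum_nonneg fun _ _ => sq_nonneg _
    rw [Fintype.sum_prod_type] at h2
    simp only [frob, (hb x hx).2, ← sq]
    refine h2.trans ?_
    gcongr
    exact le_max_right _ _

theorem integrable_inner_of_memLp_two {μ : Measure (Vec d)} {a b : Vec d → Vec d}
    (ha : MemLp a 2 μ) (hb : MemLp b 2 μ) : Integrable (fun x => ⟪a x, b x⟫) μ := by
  have h (x : Vec d) : ⟪a x, b x⟫ = ∑ i, a x i * b x i := by
    simp [PiLp.inner_apply, mul_comm]
  simp only [h]
  exact integrable_finsetSum _ fun i _ => (ha.eval_piLp i).integrable_mul (hb.eval_piLp i)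

theorem mem_Icc_of_mem_closure {Ω : Set (Vec d)} {ν : Vec d → ℝ} {a b : ℝ}
    (hν : ContinuousOn ν (closure Ω)) (h : ∀ x ∈ Ω, a ≤ ν x ∧ ν x ≤ b) {x : Vec d}
    (hx : x ∈ closure Ω) : a ≤ ν x ∧ ν x ≤ b := by
  have h' : Set.MapsTo ν Ω (Set.Icc a b) := fun x hx => h x hx
  have := h'.closure_of_continuousOn hν hx
  rwa [isClosed_Icc.closure_eq] at this

section
variable {Ω : Set (Vec d)} {T : Finset (Finset (Vec d))} {k : ℕ} (hT : IsTriangulation Ω T)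
include hT

theorem memLp_two_gradient {q : Vec d → ℝ} (hq : q ∈ PwPoly Ω T k) :
    MemLp (fun x => gradient q x) 2 (volume.restrict Ω) := by
  have := hT.isFiniteMeasure
  exact MemLp.of_eval_piLp fun i => (memLp_top_gradient hT hq i).mono_exponent le_top

theorem memLp_two_velocity {v : Vec d → Vec d} (hv : v ∈ velocitySpace Ω T k) :
    MemLp v 2 (volume.restrict Ω) := by
  have := hT.isFiniteMeasure
  exact MemLp.of_eval_piLp fun i => (memLp_top_velocity hT hv i).mono_exponent le_top

theorem integrable_norm_gradient_sq {q : Vec d → ℝ} (hq : q ∈ PwPoly Ω T k) :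
    Integrable (fun x => ‖gradient q x‖ ^ 2) (volume.restrict Ω) := by
  simpa only [real_inner_self_eq_norm_sq] using
    integrable_inner_of_memLp_two (memLp_two_gradient hT hq) (memLp_two_gradient hT hq)

theorem integrable_norm_velocity_sq {v : Vec d → Vec d} (hv : v ∈ velocitySpace Ω T k) :
    Integrable (fun x => ‖v x‖ ^ 2) (volume.restrict Ω) := by
  simpa only [real_inner_self_eq_norm_sq] using
    integrable_inner_of_memLp_two (memLp_two_velocity hT hv) (memLp_two_velocity hT hv)

end

/-- The boundary term is at most `C ν_max h⁻¹ ‖∇q‖ ‖∇v‖`.  On a face the integrand is bounded by the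
inverse inequality of the adjacent element, the area of the face is `O(h_e^(d-1))`, and the
contributions are added by the Cauchy-Schwarz inequality. -/
theorem exists_abs_boundaryTerm_le (hd : d ≠ 0) (k l : ℕ) {κ Q : ℝ} (hκ : 0 < κ) (hQ : 1 ≤ Q) :
    ∃ C : ℝ, 0 < C ∧ ∀ (Ω : Set (Vec d)) (T : Finset (Finset (Vec d))), IsTriangulation Ω T →
      ShapeRegular κ T → QuasiUniform Q T → ∀ (ν : Vec d → ℝ) (νmax : ℝ),
      ContinuousOn ν (closure Ω) → (∀ x ∈ Ω, 0 ≤ ν x ∧ ν x ≤ νmax) →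
      ∀ v ∈ velocitySpace Ω T k, ∀ q ∈ PwPoly Ω T l,
        |boundaryTerm Ω T ν q v| ≤ C * (νmax / meshSize T) *
          (√(∫ x in Ω, ‖gradient q x‖ ^ 2) * √(∫ x in Ω, frob (grad v x) (grad v x))) := by
  classical
  obtain ⟨C₁, hC₁, hle⟩ := exists_sq_derivatives_le hd k l hκ
  obtain ⟨C₂, hC₂⟩ := exists_measure_face_le hd
  refine ⟨((d : ℝ) + 1) * (2 * (d : ℝ) ^ 2 * C₁ * (C₂ + 1)) * Q, by positivity,
    fun Ω T hT hκT hQT ν νmax hν hνle v hv q hq => ?_⟩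
  have hh := hT.meshSize_pos hd
  have hνmax : 0 ≤ νmax := by
    obtain ⟨x, hx⟩ := hT.isConnected.nonempty
    exact (hνle x hx).1.trans (hνle x hx).2
  -- The contributions of the elements to `‖∇q‖²` and `‖∇v‖²`.
  let X : Finset (Vec d) → ℝ := fun e => ∫ y in elt e, ‖gradient q y‖ ^ 2
  let Y : Finset (Vec d) → ℝ := fun e => ∫ y in elt e, frob (grad v y) (grad v y)
  have hX (e) : 0 ≤ X e := integral_nonneg fun _ => sq_nonneg _
  have hY (e) : 0 ≤ Y e := integral_nonneg fun _ => frob_self_nonneg _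
  have hXsum : ∫ x in Ω, ‖gradient q x‖ ^ 2 = ∑ e ∈ T, X e :=
    hT.integral_eq_sum (integrable_norm_gradient_sq hT hq)
  have hYsum : ∫ x in Ω, frob (grad v x) (grad v x) = ∑ e ∈ T, Y e :=
    hT.integral_eq_sum (integrable_frob_grad hT hv hv)
  have hface : ∀ e ∈ T, ∀ a ∈ e, elt (face e a) ⊆ frontier Ω →
      |∫ x in elt (face e a), ν x * crossCurl (gradientWithin q (elt e) x) (outerNormal e a)
        (jac (fderivWithin ℝ v (elt e) x)) ∂(μHE[d - 1])| ≤
      (2 * (d : ℝ) ^ 2 * C₁ * (C₂ + 1)) * Q * (νmax / meshSize T) * (√(X e) * √(Y e)) := by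
    intro e he a ha hfr
    have hhe := hT.eltSize_pos hd he
    have hbound : ∀ x ∈ elt (face e a), ‖ν x * crossCurl (gradientWithin q (elt e) x)
        (outerNormal e a) (jac (fderivWithin ℝ v (elt e) x))‖ ≤
        νmax * (2 * (d : ℝ) ^ 2 * (C₁ * (eltSize e ^ d)⁻¹ * (√(X e) * √(Y e)))) := by
      intro x hx
      have hxe := elt_face_subset e a hx
      obtain ⟨hq', hv'⟩ := hle Ω T hT hκT e he x hxe
      have hνx := mem_Icc_of_mem_closure hν hνle (frontier_subset_closure (hfr hx))
      have hs : 0 ≤ C₁ * (eltSize e ^ d)⁻¹ := by positivity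
      have h1 : ‖gradientWithin q (elt e) x‖ ≤ √(C₁ * (eltSize e ^ d)⁻¹) * √(X e) := by
        rw [← Real.sqrt_mul hs]
        exact Real.le_sqrt_of_sq_le (hq' q hq)
      have h2 : √(frob (jac (fderivWithin ℝ v (elt e) x)) (jac (fderivWithin ℝ v (elt e) x))) ≤
          √(C₁ * (eltSize e ^ d)⁻¹) * √(Y e) := by
        rw [← Real.sqrt_mul hs]
        exact Real.sqrt_le_sqrt (hv' v hv)
      rw [Real.norm_eq_abs, abs_mul, abs_of_nonneg hνx.1]
      refine mul_le_mul hνx.2 ((abs_crossCurl_le _ _ (norm_outerNormal_le e a) _).trans ?_)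
        (abs_nonneg _) hνmax
      refine mul_le_mul_of_nonneg_left ((mul_le_mul h1 h2 (Real.sqrt_nonneg _)
        (by positivity)).trans (le_of_eq ?_)) (by positivity)
      nth_rewrite 3 [← Real.mul_self_sqrt hs]
      ring
    have hmeas : (μHE[d - 1] : Measure (Vec d)).real (elt (face e a)) ≤
        (C₂ + 1) * eltSize e ^ (d - 1) := by
      refine (ENNReal.toReal_le_of_le_ofReal (by positivity)
        (hC₂ e (hT.card_eq e he) a ha)).trans ?_
      gcongr
      linarith
    -- The powers of `h_e` from the two inverse inequalities and from the area combine to `h_e⁻¹`,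
    -- which quasi-uniformity compares with `h⁻¹`.
    have hinv : (eltSize e ^ d)⁻¹ * eltSize e ^ (d - 1) ≤ Q / meshSize T := by
      have h1 : eltSize e ^ d = eltSize e ^ (d - 1) * eltSize e := by
        rw [← pow_succ, Nat.sub_add_cancel (Nat.pos_of_ne_zero hd)]
      rw [h1, mul_inv, mul_comm (_)⁻¹, mul_assoc, inv_mul_cancel₀ (by positivity), mul_one,
        le_div_iff₀ hh, inv_mul_eq_div]
      exact hQT e he
    refine (norm_setIntegral_le_of_norm_le_const
      (measure_face_lt_top hd (hT.card_eq e he) ha) hbound).trans ?_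
    calc _ ≤ νmax * (2 * (d : ℝ) ^ 2 * (C₁ * (eltSize e ^ d)⁻¹ * (√(X e) * √(Y e)))) *
          ((C₂ + 1) * eltSize e ^ (d - 1)) := by gcongr
      _ = (2 * (d : ℝ) ^ 2 * C₁ * (C₂ + 1)) * νmax * (√(X e) * √(Y e)) *
          ((eltSize e ^ d)⁻¹ * eltSize e ^ (d - 1)) := by ring
      _ ≤ (2 * (d : ℝ) ^ 2 * C₁ * (C₂ + 1)) * νmax * (√(X e) * √(Y e)) * (Q / meshSize T) := by
          gcongr
      _ = _ := by ring
  set K : ℝ := (2 * (d : ℝ) ^ 2 * C₁ * (C₂ + 1)) * Q * (νmax / meshSize T) with hK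
  have hK0 : 0 ≤ K := by positivity
  have helt : ∀ e ∈ T, |∑ a ∈ e with elt (face e a) ⊆ frontier Ω,
      ∫ x in elt (face e a), ν x * crossCurl (gradientWithin q (elt e) x) (outerNormal e a)
        (jac (fderivWithin ℝ v (elt e) x)) ∂(μHE[d - 1])| ≤
      ((d : ℝ) + 1) * (K * (√(X e) * √(Y e))) := by
    intro e he
    refine (Finset.abs_sum_le_sum_abs _ _).trans ((Finset.sum_le_card_nsmul _ _
      (K * (√(X e) * √(Y e))) fun a ha => ?_).trans ?_)
    · rw [Finset.mem_filter] at ha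
      exact hface e he a ha.1 ha.2
    · rw [nsmul_eq_mul]
      refine mul_le_mul_of_nonneg_right ?_ (by positivity)
      have := Finset.card_filter_le e fun a => elt (face e a) ⊆ frontier Ω
      rw [hT.card_eq e he] at this
      exact_mod_cast this
  rw [hXsum, hYsum]
  calc |boundaryTerm Ω T ν q v|
      ≤ ∑ e ∈ T, ((d : ℝ) + 1) * (K * (√(X e) * √(Y e))) := by
        unfold boundaryTerm
        refine (Finset.abs_sum_le_sum_abs _ _).trans (Finset.sum_le_sum fun e he => ?_)
        convert helt e he
    _ = ((d : ℝ) + 1) * K * ∑ e ∈ T, √(X e) * √(Y e) := by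
        rw [Finset.mul_sum]
        exact Finset.sum_congr rfl fun e _ => by ring
    _ ≤ ((d : ℝ) + 1) * K * (√(∑ e ∈ T, X e) * √(∑ e ∈ T, Y e)) :=
        mul_le_mul_of_nonneg_left (Real.sum_sqrt_mul_sqrt_le T hX hY) (by positivity)
    _ = _ := by rw [hK]; ring

/-! ### Integrability of the terms of the discrete problem -/

section
variable {Ω : Set (Vec d)} {T : Finset (Finset (Vec d))} {k : ℕ} (hT : IsTriangulation Ω T)
include hT

theorem memLp_top_symGrad {v : Vec d → Vec d} (hv : v ∈ velocitySpace Ω T k) (i j : Fin d) :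
    MemLp (fun x => symGrad v x i j) ⊤ (volume.restrict Ω) :=
  ((memLp_top_grad hT hv i j).add (memLp_top_grad hT hv j i)).const_mul (1 / 2)

theorem memLp_top_divg {v : Vec d → Vec d} (hv : v ∈ velocitySpace Ω T k) :
    MemLp (fun x => divg v x) ⊤ (volume.restrict Ω) := by
  have h : MemLp (fun x => ∑ i, grad v x i i) ⊤ (volume.restrict Ω) :=
    memLp_finsetSum _ fun i _ => memLp_top_grad hT hv i i
  exact h

theorem integrable_viscous {ν : Vec d → ℝ} (hν : MemLp ν ⊤ (volume.restrict Ω))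
    {u v : Vec d → Vec d} (hu : u ∈ velocitySpace Ω T k) (hv : v ∈ velocitySpace Ω T k) :
    Integrable (fun x => 2 * ν x * frob (symGrad u x) (symGrad v x)) (volume.restrict Ω) := by
  have := hT.isFiniteMeasure
  have h : MemLp (fun x => frob (symGrad u x) (symGrad v x)) ⊤ (volume.restrict Ω) :=
    memLp_finsetSum _ fun i _ => memLp_finsetSum _ fun j _ =>
      (memLp_top_symGrad hT hv i j).mul' (memLp_top_symGrad hT hu i j)
  exact integrable_mul_of_memLp_top (hν.const_mul 2) h

theorem integrable_mul_divg {l : ℕ} {p : Vec d → ℝ} (hp : p ∈ PwPoly Ω T l) {v : Vec d → Vec d}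
    (hv : v ∈ velocitySpace Ω T k) :
    Integrable (fun x => p x * divg v x) (volume.restrict Ω) := by
  have := hT.isFiniteMeasure
  exact integrable_mul_of_memLp_top (memLp_top_pwPoly hT hp) (memLp_top_divg hT hv)

theorem memLp_two_viscousResidual {G : Vec d → Vec d} (hG : MemLp G ⊤ (volume.restrict Ω))
    {v : Vec d → Vec d} (hv : v ∈ velocitySpace Ω T k) :
    MemLp (fun x => viscousResidual G v x) 2 (volume.restrict Ω) := by
  have := hT.isFiniteMeasure
  refine MemLp.of_eval_piLp fun i => MemLp.mono_exponent (q := ⊤) ?_ le_top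
  have h : MemLp (fun x => ∑ j, grad v x j i * G x j) ⊤ (volume.restrict Ω) :=
    memLp_finsetSum _ fun j _ => (hG.eval_piLp j).mul' (memLp_top_grad hT hv j i)
  exact h.const_mul 2

theorem integrable_residual {l : ℕ} {G : Vec d → Vec d} (hG : MemLp G ⊤ (volume.restrict Ω)) (σ : ℝ)
    {u : Vec d → Vec d} (hu : u ∈ velocitySpace Ω T k) {p q : Vec d → ℝ} (hp : p ∈ PwPoly Ω T l)
    (hq : q ∈ PwPoly Ω T l) {f : Vec d → Vec d} (hf : MemLp f 2 (volume.restrict Ω)) :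
    Integrable (fun x => ⟪gradient q x, gradient p x + σ • u x - viscousResidual G u x - f x⟫)
      (volume.restrict Ω) :=
  integrable_inner_of_memLp_two (memLp_two_gradient hT hq)
    ((((memLp_two_gradient hT hp).add ((memLp_two_velocity hT hu).const_smul σ)).sub
      (memLp_two_viscousResidual hT hG hu)).sub hf)

end

/-! ### Coercivity -/

theorem norm_viscousResidual_sq_le (G : Vec d → Vec d) (u : Vec d → Vec d) (x : Vec d) :
    ‖viscousResidual G u x‖ ^ 2 ≤ 4 * frob (grad u x) (grad u x) * ‖G x‖ ^ 2 := by
  have h (i : Fin d) : viscousResidual G u x i = 2 * ∑ j, grad u x j i * G x j := rfl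
  rw [EuclideanSpace.real_norm_sq_eq, EuclideanSpace.real_norm_sq_eq]
  have hfrob : frob (grad u x) (grad u x) = ∑ i, ∑ j, grad u x j i ^ 2 := by
    rw [frob, Finset.sum_comm]
    simp only [sq]
  rw [hfrob, mul_assoc, Finset.sum_mul, Finset.mul_sum]
  refine Finset.sum_le_sum fun i _ => ?_
  rw [h, mul_pow]
  have := Finset.sum_mul_sq_le_sq_mul_sq Finset.univ (fun j => grad u x j i) fun j => G x j
  linarith

/-- The pressure residual bounded from below by Young's inequality. -/
theorem inner_residual_ge {g v w : Vec d} {σ δ N D : ℝ} (hσ : 0 < σ) (hδ : 0 < δ)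
    (hδσ : δ * σ ≤ 1 / 3) (hw : ‖w‖ ^ 2 ≤ 4 * D * N ^ 2) :
    δ * (2 / 3) * ‖g‖ ^ 2 - σ / 2 * ‖v‖ ^ 2 - 6 * δ * N ^ 2 * D ≤ δ * ⟪g, g + σ • v - w⟫ := by
  rw [inner_sub_right, inner_add_right, real_inner_self_eq_norm_sq, inner_smul_right]
  have h1 : -(‖g‖ * ‖v‖) ≤ ⟪g, v⟫ := (abs_le.1 (abs_real_inner_le_norm g v)).1
  have h2 : ⟪g, w⟫ ≤ ‖g‖ * ‖w‖ := real_inner_le_norm g w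
  have h3 : ‖g‖ * ‖w‖ ≤ 1 / 6 * ‖g‖ ^ 2 + 3 / 2 * ‖w‖ ^ 2 := by
    nlinarith [sq_nonneg (‖g‖ - 3 * ‖w‖)]
  have h4 : ‖g‖ * ‖v‖ * (δ * σ) ≤ δ / 6 * ‖g‖ ^ 2 + σ / 2 * ‖v‖ ^ 2 := by
    have h5 : 0 ≤ σ / 2 * (δ * ‖g‖ - ‖v‖) ^ 2 := by positivity
    have h6 : δ * σ * (δ * ‖g‖ ^ 2) ≤ 1 / 3 * (δ * ‖g‖ ^ 2) := by gcongr
    nlinarith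
  have h7 : -(‖g‖ * ‖v‖) * (δ * σ) ≤ ⟪g, v⟫ * (δ * σ) := by gcongr
  have h8 : δ * ⟪g, w⟫ ≤ δ * (1 / 6 * ‖g‖ ^ 2 + 6 * (N ^ 2 * D)) := by
    gcongr
    linarith
  linarith

theorem norm_le_supNorm_ae {Ω : Set (Vec d)} {G : Vec d → Vec d}
    (hG : MemLp G ⊤ (volume.restrict Ω)) : ∀ᵐ x ∂volume.restrict Ω, ‖G x‖ ≤ supNorm Ω G := by
  filter_upwards [ae_le_eLpNormEssSup (f := G) (μ := volume.restrict Ω)] with x hx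
  rw [← eLpNorm_exponent_top] at hx
  rw [supNorm, ← toReal_enorm]
  exact ENNReal.toReal_mono hG.2.ne hx

theorem energyNorm_sq {Ω : Set (Vec d)} {σ νmin δ : ℝ} (hσ : 0 ≤ σ) (hν : 0 ≤ νmin) (hδ : 0 ≤ δ)
    (v : Vec d → Vec d) (q : Vec d → ℝ) :
    energyNorm Ω σ νmin δ v q ^ 2 = σ * (∫ x in Ω, ‖v x‖ ^ 2)
      + νmin * (∫ x in Ω, frob (grad v x) (grad v x)) + δ * ∫ x in Ω, ‖gradient q x‖ ^ 2 := by
  have h1 : 0 ≤ ∫ x in Ω, ‖v x‖ ^ 2 := integral_nonneg fun _ => sq_nonneg _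
  have h2 : 0 ≤ ∫ x in Ω, frob (grad v x) (grad v x) := integral_nonneg fun _ => frob_self_nonneg _
  have h3 : 0 ≤ ∫ x in Ω, ‖gradient q x‖ ^ 2 := integral_nonneg fun _ => sq_nonneg _
  exact Real.sq_sqrt (by positivity)

/-- Coercivity of the stabilised form, given a bound `B` for the boundary term. -/
theorem half_energyNorm_sq_le_formSD {Ω : Set (Vec d)} {T : Finset (Finset (Vec d))} {k l : ℕ}
    (hT : IsTriangulation Ω T) {σ δ νmin B : ℝ} {ν : Vec d → ℝ} {G : Vec d → Vec d} (hσ : 0 < σ)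
    (hδ : 0 < δ) (hνmin : 0 < νmin) (hν : MemLp ν ⊤ (volume.restrict Ω))
    (hνle : ∀ x ∈ Ω, νmin ≤ ν x) (hG : MemLp G ⊤ (volume.restrict Ω)) (hδσ : δ * σ ≤ 1 / 3)
    (hδν : δ * (12 * supNorm Ω G ^ 2 + 3 * B ^ 2) ≤ νmin) {v : Vec d → Vec d}
    (hv : v ∈ velocitySpace Ω T k) {q : Vec d → ℝ} (hq : q ∈ PwPoly Ω T l)
    (hB : |boundaryTerm Ω T ν q v| ≤
      B * (√(∫ x in Ω, ‖gradient q x‖ ^ 2) * √(∫ x in Ω, frob (grad v x) (grad v x)))) :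
    (1 / 2) * energyNorm Ω σ νmin δ v q ^ 2 ≤ formSD Ω T σ δ ν G v q v q := by
  have := hT.isFiniteMeasure
  have hiv := integrable_norm_velocity_sq hT hv
  have hig := integrable_norm_gradient_sq hT hq
  have hiD := integrable_frob_grad hT hv hv
  rw [energyNorm_sq hσ.le hνmin.le hδ.le]
  unfold formSD momentumForm continuityForm
  simp only [real_inner_self_eq_norm_sq, Pi.zero_apply, sub_zero]
  have hvisc : νmin * ∫ x in Ω, frob (grad v x) (grad v x) ≤
      ∫ x in Ω, 2 * ν x * frob (symGrad v x) (symGrad v x) := by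
    refine (mul_le_mul_of_nonneg_left (integral_frob_grad_le hT hv) hνmin.le).trans ?_
    rw [← integral_const_mul]
    refine setIntegral_mono_on ?_ (integrable_viscous hT hν hv hv) hT.isOpen.measurableSet
      fun x hx => ?_
    · have h := (integrable_viscous hT (memLp_const (1 : ℝ)) hv hv).const_mul νmin
      simp only [mul_one] at h
      exact h
    · have h1 := hνle x hx
      have h2 := frob_self_nonneg (symGrad v x)
      nlinarith
  have hres : δ * (2 / 3) * (∫ x in Ω, ‖gradient q x‖ ^ 2) - σ / 2 * (∫ x in Ω, ‖v x‖ ^ 2)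
      - 6 * δ * supNorm Ω G ^ 2 * (∫ x in Ω, frob (grad v x) (grad v x)) ≤
      δ * ∫ x in Ω, ⟪gradient q x, gradient q x + σ • v x - viscousResidual G v x⟫ := by
    have hi1 : Integrable (fun x => δ * (2 / 3) * ‖gradient q x‖ ^ 2 - σ / 2 * ‖v x‖ ^ 2)
        (volume.restrict Ω) := (hig.const_mul _).sub (hiv.const_mul _)
    rw [← integral_const_mul, ← integral_const_mul, ← integral_const_mul, ← integral_const_mul,
      ← integral_sub (hig.const_mul _) (hiv.const_mul _), ← integral_sub hi1 (hiD.const_mul _)]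
    refine integral_mono_ae (hi1.sub (hiD.const_mul _)) ?_ ?_
    · have := (integrable_residual hT hG σ hv hq hq (f := 0) MemLp.zero').const_mul δ
      simpa only [Pi.zero_apply, sub_zero] using this
    · filter_upwards [norm_le_supNorm_ae hG] with x hx
      refine inner_residual_ge hσ hδ hδσ ((norm_viscousResidual_sq_le G v x).trans ?_)
      have := frob_self_nonneg (grad v x)
      gcongr
  set g : ℝ := ∫ x in Ω, ‖gradient q x‖ ^ 2 with hg
  set D : ℝ := ∫ x in Ω, frob (grad v x) (grad v x) with hD
  have hg0 : 0 ≤ g := integral_nonneg fun _ => sq_nonneg _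
  have hD0 : 0 ≤ D := integral_nonneg fun _ => frob_self_nonneg _
  have hbd : -(δ * (g / 6 + 3 / 2 * B ^ 2 * D)) ≤ δ * boundaryTerm Ω T ν q v := by
    rw [← mul_neg]
    refine mul_le_mul_of_nonneg_left ?_ hδ.le
    have h1 := (abs_le.1 hB).1
    have h2 : B * (√g * √D) ≤ g / 6 + 3 / 2 * B ^ 2 * D := by
      nlinarith [sq_nonneg (√g - 3 * B * √D), Real.sq_sqrt hg0, Real.sq_sqrt hD0]
    linarith
  have hfin : δ * (12 * supNorm Ω G ^ 2 + 3 * B ^ 2) * D ≤ νmin * D := by gcongr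
  nlinarith

/-! ### Definiteness -/

theorem velocity_eq_zero_of_integral {Ω : Set (Vec d)} {T : Finset (Finset (Vec d))} {k : ℕ}
    (hT : IsTriangulation Ω T) {v : Vec d → Vec d} (hv : v ∈ velocitySpace Ω T k)
    (h : ∫ x in Ω, ‖v x‖ ^ 2 = 0) : v = 0 := by
  have h1 := (integral_eq_zero_iff_of_nonneg (fun _ => sq_nonneg _)
    (integrable_norm_velocity_sq hT hv)).1 h
  have hc : ContinuousOn v Ω := by
    have : ContinuousOn (fun x => WithLp.toLp 2 fun i => v x i) Ω :=
      (PiLp.continuous_toLp 2 _).comp_continuousOn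
        (continuousOn_pi.2 fun i => (hv.1 i).1.mono subset_closure)
    exact this
  have h2 : v =ᵐ[volume.restrict Ω] 0 := by
    filter_upwards [h1] with x hx
    simpa using hx
  have h3 := Measure.eqOn_open_of_ae_eq h2 hT.isOpen hc continuousOn_const
  ext1 x
  by_cases hx : x ∈ Ω
  · exact h3 hx
  · exact velocity_eq_zero_of_notMem hT hv hx

/-- A discrete function with vanishing gradient is constant on every element; hence it takes
finitely many values on the connected domain and is constant. -/
theorem pressure_eq_zero_of_integral {Ω : Set (Vec d)} {T : Finset (Finset (Vec d))} {l : ℕ}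
    (hT : IsTriangulation Ω T) {q : Vec d → ℝ} (hq : q ∈ pressureSpace Ω T l)
    (h : ∫ x in Ω, ‖gradient q x‖ ^ 2 = 0) : q = 0 := by
  have h1 := (integral_eq_zero_iff_of_nonneg (fun _ => sq_nonneg _)
    (integrable_norm_gradient_sq hT hq.1)).1 h
  have helt : ∀ e ∈ T, ∃ c : ℝ, ∀ x ∈ elt e, q x = c := by
    intro e he
    obtain ⟨P, -, hP, hi, -⟩ := exists_poly hT hq.1 he
    obtain ⟨c, hc⟩ := hT.interior_elt_nonempty he
    have hz (i : Fin d) : Set.EqOn (evalPoly (MvPolynomial.pderiv i P)) 0 (interior (elt e)) := by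
      refine Measure.eqOn_open_of_ae_eq (μ := volume) ?_ isOpen_interior
        (continuous_evalPoly _).continuousOn continuousOn_const
      filter_upwards [ae_restrict_of_ae_restrict_of_subset (hT.interior_elt_subset he) h1,
        ae_restrict_mem isOpen_interior.measurableSet] with x hx hxe
      have hx' : gradient q x = 0 := by simpa using hx
      rw [← (hi x hxe).2, hx']
      rfl
    have hconst : Set.EqOn (evalPoly P) (fun _ => evalPoly P c) (interior (elt e)) := by
      intro x hx
      refine (convex_elt e).interior.is_const_of_fderivWithin_eq_zero (𝕜 := ℝ)
        (fun y _ => (hasFDerivAt_evalPoly P y).differentiableAt.differentiableWithinAt)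
        (fun y hy => ?_) hx hc
      rw [fderivWithin_of_isOpen isOpen_interior hy, (hasFDerivAt_evalPoly P y).fderiv]
      simp [hz _ hy]
    have hcl := hconst.closure (continuous_evalPoly P) continuous_const
    refine ⟨evalPoly P c, fun x hx => (hP x hx).trans (hcl ?_)⟩
    rw [(convex_elt e).closure_interior_eq_closure_of_nonempty_interior
      (hT.interior_elt_nonempty he)]
    exact subset_closure hx
  choose! c hc using helt
  have hfin : (q '' Ω).Finite := by
    refine (T.finite_toSet.image c).subset ?_
    rintro _ ⟨x, hx, rfl⟩
    have := subset_closure hx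
    rw [hT.closure_eq, Set.mem_iUnion₂] at this
    obtain ⟨e, he, hxe⟩ := this
    exact ⟨e, he, (hc e he x hxe).symm⟩
  have hsub : (q '' Ω).Subsingleton :=
    hfin.countable.isTotallyDisconnected _ subset_rfl
      (hT.isConnected.isPreconnected.image q (hq.1.1.mono subset_closure))
  obtain ⟨x₀, hx₀⟩ := hT.isConnected.nonempty
  have hconst : ∀ x ∈ Ω, q x = q x₀ := fun x hx =>
    hsub (Set.mem_image_of_mem q hx) (Set.mem_image_of_mem q hx₀)
  have hq0 : q x₀ = 0 := by
    have h2 := hq.2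
    rw [setIntegral_congr_fun hT.isOpen.measurableSet hconst, setIntegral_const, smul_eq_mul,
      mul_eq_zero] at h2
    refine h2.resolve_left ?_
    have hpos := hT.isOpen.measure_pos volume hT.isConnected.nonempty
    have := hT.isFiniteMeasure
    have hlt : volume Ω < ⊤ := by simpa using measure_lt_top (volume.restrict Ω) Set.univ
    exact (ENNReal.toReal_pos hpos.ne' hlt.ne).ne'
  have hΩ : Set.EqOn q (fun _ => 0) Ω := fun x hx => (hconst x hx).trans hq0
  ext1 x
  by_cases hx : x ∈ closure Ω
  · exact hΩ.of_subset_closure hq.1.1 continuousOn_const subset_closure subset_rfl hx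
  · exact hq.1.2.1 x hx

/-! ### Bilinearity -/

theorem gradient_smul_add {p q : Vec d → ℝ} {x : Vec d} (hp : DifferentiableAt ℝ p x)
    (hq : DifferentiableAt ℝ q x) (a : ℝ) :
    gradient (a • p + q) x = a • gradient p x + gradient q x := by
  ext i
  rw [PiLp.add_apply, PiLp.smul_apply, gradient_apply, gradient_apply, gradient_apply,
    fderiv_add (hp.const_smul a) hq, fderiv_const_smul hp]
  rfl

theorem gradientWithin_smul_add {p q : Vec d → ℝ} {s : Set (Vec d)} {x : Vec d}
    (hp : DifferentiableWithinAt ℝ p s x) (hq : DifferentiableWithinAt ℝ q s x)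
    (hs : UniqueDiffWithinAt ℝ s x) (a : ℝ) :
    gradientWithin (a • p + q) s x = a • gradientWithin p s x + gradientWithin q s x := by
  ext i
  rw [PiLp.add_apply, PiLp.smul_apply, gradientWithin_apply, gradientWithin_apply,
    gradientWithin_apply, fderivWithin_add hs (hp.const_smul a) hq, fderivWithin_const_smul hs hp]
  rfl

theorem grad_smul_add {u v : Vec d → Vec d} {x : Vec d} (hu : DifferentiableAt ℝ u x)
    (hv : DifferentiableAt ℝ v x) (a : ℝ) : grad (a • u + v) x = a • grad u x + grad v x := by
  rw [grad, fderiv_add (hu.const_smul a) hv, fderiv_const_smul hu, jac_add, jac_smul]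
  rfl

theorem symGrad_smul_add {u v : Vec d → Vec d} {x : Vec d} (hu : DifferentiableAt ℝ u x)
    (hv : DifferentiableAt ℝ v x) (a : ℝ) :
    symGrad (a • u + v) x = a • symGrad u x + symGrad v x := by
  ext i j
  simp only [symGrad, grad_smul_add hu hv, Matrix.smul_apply, Matrix.add_apply,
    Matrix.transpose_apply, smul_eq_mul]
  ring

theorem divg_smul_add {u v : Vec d → Vec d} {x : Vec d} (hu : DifferentiableAt ℝ u x)
    (hv : DifferentiableAt ℝ v x) (a : ℝ) : divg (a • u + v) x = a * divg u x + divg v x := by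
  simp [divg, grad_smul_add hu hv]

theorem viscousResidual_smul_add (G : Vec d → Vec d) {u v : Vec d → Vec d} {x : Vec d}
    (hu : DifferentiableAt ℝ u x) (hv : DifferentiableAt ℝ v x) (a : ℝ) :
    viscousResidual G (a • u + v) x = a • viscousResidual G u x + viscousResidual G v x := by
  ext i
  simp only [viscousResidual, grad_smul_add hu hv, Matrix.transpose_add, Matrix.transpose_smul,
    Matrix.add_mulVec, Matrix.smul_mulVec, PiLp.add_apply, PiLp.smul_apply, Pi.smul_apply,
    Pi.add_apply, smul_eq_mul]
  ring

theorem frob_smul_add_left (a : ℝ) (A B M : Matrix (Fin d) (Fin d) ℝ) :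
    frob (a • A + B) M = a * frob A M + frob B M := by
  simp only [frob, Finset.mul_sum, ← Finset.sum_add_distrib, Matrix.add_apply, Matrix.smul_apply,
    smul_eq_mul]
  exact Finset.sum_congr rfl fun i _ => Finset.sum_congr rfl fun j _ => by ring

theorem frob_comm (A B : Matrix (Fin d) (Fin d) ℝ) : frob A B = frob B A := by
  simp only [frob, mul_comm]

theorem crossCurl_smul_add_left (t : ℝ) (a b n : Vec d) (J : Matrix (Fin d) (Fin d) ℝ) :
    crossCurl (t • a + b) n J = t * crossCurl a n J + crossCurl b n J := by
  simp only [crossCurl, Finset.mul_sum, ← Finset.sum_add_distrib, PiLp.add_apply, PiLp.smul_apply,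
    smul_eq_mul]
  exact Finset.sum_congr rfl fun i _ => Finset.sum_congr rfl fun j _ => by ring

theorem crossCurl_smul_add_right (t : ℝ) (a n : Vec d) (J K : Matrix (Fin d) (Fin d) ℝ) :
    crossCurl a n (t • J + K) = t * crossCurl a n J + crossCurl a n K := by
  simp only [crossCurl, Finset.mul_sum, ← Finset.sum_add_distrib, Matrix.add_apply,
    Matrix.smul_apply, smul_eq_mul]
  exact Finset.sum_congr rfl fun i _ => Finset.sum_congr rfl fun j _ => by ring

/-- The integrand of the volume part of the stabilised form. -/
noncomputable def volumeIntegrand (σ δ : ℝ) (ν : Vec d → ℝ) (G : Vec d → Vec d)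
    (v : Vec d → Vec d) (q : Vec d → ℝ) (u : Vec d → Vec d) (p : Vec d → ℝ) (x : Vec d) : ℝ :=
  σ * ⟪u x, v x⟫ + 2 * ν x * frob (symGrad u x) (symGrad v x) - p x * divg v x + q x * divg u x
    + δ * ⟪gradient q x, gradient p x + σ • u x - viscousResidual G u x⟫

section
variable {Ω : Set (Vec d)} {T : Finset (Finset (Vec d))} {k l : ℕ} (hT : IsTriangulation Ω T)
  {ν : Vec d → ℝ} {G : Vec d → Vec d}
include hT

theorem integrable_residual_zero (hG : MemLp G ⊤ (volume.restrict Ω)) (σ : ℝ)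
    {u : Vec d → Vec d} (hu : u ∈ velocitySpace Ω T k) {p q : Vec d → ℝ} (hp : p ∈ PwPoly Ω T l)
    (hq : q ∈ PwPoly Ω T l) :
    Integrable (fun x => ⟪gradient q x, gradient p x + σ • u x - viscousResidual G u x⟫)
      (volume.restrict Ω) := by
  simpa only [Pi.zero_apply, sub_zero] using
    integrable_residual hT hG σ hu hp hq (f := 0) MemLp.zero'

theorem integrable_volumeIntegrand (σ δ : ℝ) (hν : MemLp ν ⊤ (volume.restrict Ω))
    (hG : MemLp G ⊤ (volume.restrict Ω)) {u v : Vec d → Vec d} (hu : u ∈ velocitySpace Ω T k)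
    (hv : v ∈ velocitySpace Ω T k) {p q : Vec d → ℝ} (hp : p ∈ PwPoly Ω T l)
    (hq : q ∈ PwPoly Ω T l) :
    Integrable (volumeIntegrand σ δ ν G v q u p) (volume.restrict Ω) :=
  (((((integrable_inner_of_memLp_two (memLp_two_velocity hT hu)
    (memLp_two_velocity hT hv)).const_mul σ).add (integrable_viscous hT hν hu hv)).sub
    (integrable_mul_divg hT hp hv)).add (integrable_mul_divg hT hq hu)).add
    ((integrable_residual_zero hT hG σ hu hp hq).const_mul δ)

theorem formSD_eq (σ δ : ℝ) (hν : MemLp ν ⊤ (volume.restrict Ω))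
    (hG : MemLp G ⊤ (volume.restrict Ω)) {u v : Vec d → Vec d} (hu : u ∈ velocitySpace Ω T k)
    (hv : v ∈ velocitySpace Ω T k) {p q : Vec d → ℝ} (hp : p ∈ PwPoly Ω T l)
    (hq : q ∈ PwPoly Ω T l) :
    formSD Ω T σ δ ν G v q u p =
      (∫ x in Ω, volumeIntegrand σ δ ν G v q u p x) + δ * boundaryTerm Ω T ν q u := by
  have h1 : Integrable (fun x => σ * ⟪u x, v x⟫) (volume.restrict Ω) :=
    (integrable_inner_of_memLp_two (memLp_two_velocity hT hu)
      (memLp_two_velocity hT hv)).const_mul σ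
  have h2 := integrable_viscous hT hν hu hv
  have h3 := integrable_mul_divg hT hp hv
  have h4 := integrable_mul_divg hT hq hu
  have h5 := (integrable_residual_zero hT hG σ hu hp hq).const_mul δ
  have h12 : Integrable (fun x => σ * ⟪u x, v x⟫ + 2 * ν x * frob (symGrad u x) (symGrad v x))
    (volume.restrict Ω) := h1.add h2
  have h123 : Integrable (fun x => σ * ⟪u x, v x⟫ + 2 * ν x * frob (symGrad u x) (symGrad v x)
    - p x * divg v x) (volume.restrict Ω) := h12.sub h3
  have h1234 : Integrable (fun x => σ * ⟪u x, v x⟫ + 2 * ν x * frob (symGrad u x) (symGrad v x)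
    - p x * divg v x + q x * divg u x) (volume.restrict Ω) := h123.add h4
  unfold volumeIntegrand
  rw [integral_add h1234 h5, integral_add h123 h4, integral_sub h12 h3, integral_add h1 h2,
    integral_const_mul, integral_const_mul]
  simp only [formSD, momentumForm, continuityForm, Pi.zero_apply, sub_zero]
  ring

theorem volumeIntegrand_smul_add_left (σ δ : ℝ) {v v' : Vec d → Vec d}
    (hv : v ∈ velocitySpace Ω T k) (hv' : v' ∈ velocitySpace Ω T k) {q q' : Vec d → ℝ}
    (hq : q ∈ PwPoly Ω T l) (hq' : q' ∈ PwPoly Ω T l) (a : ℝ) (u : Vec d → Vec d)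
    (p : Vec d → ℝ) :
    volumeIntegrand σ δ ν G (a • v + v') (a • q + q') u p =ᵐ[volume.restrict Ω] fun x =>
      a * volumeIntegrand σ δ ν G v q u p x + volumeIntegrand σ δ ν G v' q' u p x := by
  filter_upwards [ae_differentiableAt_velocity hT hv, ae_differentiableAt_velocity hT hv',
    ae_differentiableAt_pwPoly hT hq, ae_differentiableAt_pwPoly hT hq'] with x h1 h2 h3 h4
  simp only [volumeIntegrand, symGrad_smul_add h1 h2, divg_smul_add h1 h2, gradient_smul_add h3 h4,
    frob_comm (symGrad u x), frob_smul_add_left, Pi.add_apply, Pi.smul_apply, inner_add_left,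
    inner_add_right, real_inner_smul_left, real_inner_smul_right, smul_eq_mul, inner_sub_right]
  ring

theorem volumeIntegrand_smul_add_right (σ δ : ℝ) {u u' : Vec d → Vec d}
    (hu : u ∈ velocitySpace Ω T k) (hu' : u' ∈ velocitySpace Ω T k) {p p' : Vec d → ℝ}
    (hp : p ∈ PwPoly Ω T l) (hp' : p' ∈ PwPoly Ω T l) (a : ℝ) (v : Vec d → Vec d) (q : Vec d → ℝ) :
    volumeIntegrand σ δ ν G v q (a • u + u') (a • p + p') =ᵐ[volume.restrict Ω] fun x =>
      a * volumeIntegrand σ δ ν G v q u p x + volumeIntegrand σ δ ν G v q u' p' x := by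
  filter_upwards [ae_differentiableAt_velocity hT hu, ae_differentiableAt_velocity hT hu',
    ae_differentiableAt_pwPoly hT hp, ae_differentiableAt_pwPoly hT hp'] with x h1 h2 h3 h4
  simp only [volumeIntegrand, symGrad_smul_add h1 h2, divg_smul_add h1 h2, gradient_smul_add h3 h4,
    viscousResidual_smul_add G h1 h2, frob_smul_add_left, Pi.add_apply, Pi.smul_apply,
    inner_add_left, inner_add_right, real_inner_smul_left, real_inner_smul_right, smul_eq_mul,
    inner_sub_right]
  ring

theorem integrableOn_face (hd : d ≠ 0) (hν : ContinuousOn ν (closure Ω)) {e : Finset (Vec d)}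
    (he : e ∈ T) {a : Vec d} (ha : a ∈ e) {q : Vec d → ℝ} (hq : q ∈ PwPoly Ω T l)
    {u : Vec d → Vec d} (hu : u ∈ velocitySpace Ω T k) (n : Vec d) :
    IntegrableOn (fun x => ν x * crossCurl (gradientWithin q (elt e) x) n
      (jac (fderivWithin ℝ u (elt e) x))) (elt (face e a)) (μHE[d - 1]) := by
  obtain ⟨P, -, -, -, hP⟩ := exists_poly hT hq he
  obtain ⟨R, -, -, -, hR⟩ := exists_poly_velocity hT hu he
  have hsub := elt_face_subset e a
  refine memLp_one_iff_integrable.1 (memLp_of_continuousOn_isCompact ?_ (isCompact_elt _)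
    (measure_face_lt_top hd (hT.card_eq e he) ha) 1)
  have hc : Continuous fun x => (1 / 2) * ∑ i, ∑ j,
      (evalPoly (MvPolynomial.pderiv i P) x * n j - evalPoly (MvPolynomial.pderiv j P) x * n i) *
        (evalPoly (MvPolynomial.pderiv i (R j)) x - evalPoly (MvPolynomial.pderiv j (R i)) x) := by
    have := @continuous_evalPoly d
    fun_prop
  refine ((hν.mono (hsub.trans (hT.elt_subset he))).mul hc.continuousOn).congr fun x hx => ?_
  simp only [Pi.mul_apply, crossCurl, (hP x (hsub hx)).2, (hR x (hsub hx)).2]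

theorem boundaryTerm_smul_add_left (hd : d ≠ 0) (hν : ContinuousOn ν (closure Ω))
    {q q' : Vec d → ℝ} (hq : q ∈ PwPoly Ω T l) (hq' : q' ∈ PwPoly Ω T l) {u : Vec d → Vec d}
    (hu : u ∈ velocitySpace Ω T k) (a : ℝ) :
    boundaryTerm Ω T ν (a • q + q') u = a * boundaryTerm Ω T ν q u + boundaryTerm Ω T ν q' u := by
  classical
  unfold boundaryTerm
  simp only [Finset.mul_sum, ← Finset.sum_add_distrib]
  refine Finset.sum_congr rfl fun e he => Finset.sum_congr rfl fun b hb => ?_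
  have hbe := Finset.mem_of_mem_filter b hb
  obtain ⟨P, -, -, -, hP⟩ := exists_poly hT hq he
  obtain ⟨P', -, -, -, hP'⟩ := exists_poly hT hq' he
  rw [← integral_const_mul, ← integral_add
    ((integrableOn_face hT hd hν he hbe hq hu _).const_mul a)
    (integrableOn_face hT hd hν he hbe hq' hu _)]
  refine setIntegral_congr_fun (measurableSet_elt _) fun x hx => ?_
  have hxe := elt_face_subset e b hx
  beta_reduce
  rw [gradientWithin_smul_add (hP x hxe).1 (hP' x hxe).1 (hT.uniqueDiffOn_elt he x hxe),
    crossCurl_smul_add_left]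
  ring

theorem boundaryTerm_smul_add_right (hd : d ≠ 0) (hν : ContinuousOn ν (closure Ω))
    {q : Vec d → ℝ} (hq : q ∈ PwPoly Ω T l) {u u' : Vec d → Vec d}
    (hu : u ∈ velocitySpace Ω T k) (hu' : u' ∈ velocitySpace Ω T k) (a : ℝ) :
    boundaryTerm Ω T ν q (a • u + u') = a * boundaryTerm Ω T ν q u + boundaryTerm Ω T ν q u' := by
  classical
  unfold boundaryTerm
  simp only [Finset.mul_sum, ← Finset.sum_add_distrib]
  refine Finset.sum_congr rfl fun e he => Finset.sum_congr rfl fun b hb => ?_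
  have hbe := Finset.mem_of_mem_filter b hb
  obtain ⟨P, -, -, -, hP⟩ := exists_poly_velocity hT hu he
  obtain ⟨P', -, -, -, hP'⟩ := exists_poly_velocity hT hu' he
  rw [← integral_const_mul, ← integral_add
    ((integrableOn_face hT hd hν he hbe hq hu _).const_mul a)
    (integrableOn_face hT hd hν he hbe hq hu' _)]
  refine setIntegral_congr_fun (measurableSet_elt _) fun x hx => ?_
  have hxe := elt_face_subset e b hx
  have hs := hT.uniqueDiffOn_elt he x hxe
  beta_reduce
  rw [fderivWithin_add hs ((hP x hxe).1.const_smul a) (hP' x hxe).1,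
    fderivWithin_const_smul hs (hP x hxe).1, jac_add, jac_smul, crossCurl_smul_add_right]
  ring

theorem formSD_smul_add_left (hd : d ≠ 0) (σ δ : ℝ) (hν : IsW1Infty Ω ν G) {v v' : Vec d → Vec d}
    (hv : v ∈ velocitySpace Ω T k) (hv' : v' ∈ velocitySpace Ω T k) {q q' : Vec d → ℝ}
    (hq : q ∈ PwPoly Ω T l) (hq' : q' ∈ PwPoly Ω T l) {u : Vec d → Vec d}
    (hu : u ∈ velocitySpace Ω T k) {p : Vec d → ℝ} (hp : p ∈ PwPoly Ω T l) (a : ℝ) :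
    formSD Ω T σ δ ν G (a • v + v') (a • q + q') u p =
      a * formSD Ω T σ δ ν G v q u p + formSD Ω T σ δ ν G v' q' u p := by
  have hva : a • v + v' ∈ velocitySpace Ω T k :=
    (velocitySubmodule Ω T k).add_mem ((velocitySubmodule Ω T k).smul_mem a hv) hv'
  rw [formSD_eq hT σ δ hν.memLp hν.memLp_grad hu hva hp (pwPoly_smul_add hq hq' a),
    formSD_eq hT σ δ hν.memLp hν.memLp_grad hu hv hp hq,
    formSD_eq hT σ δ hν.memLp hν.memLp_grad hu hv' hp hq',
    integral_congr_ae (volumeIntegrand_smul_add_left hT σ δ hv hv' hq hq' a u p),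
    integral_add ((integrable_volumeIntegrand hT σ δ hν.memLp hν.memLp_grad hu hv hp
      hq).const_mul a)
      (integrable_volumeIntegrand hT σ δ hν.memLp hν.memLp_grad hu hv' hp hq'),
    integral_const_mul, boundaryTerm_smul_add_left hT hd hν.continuousOn hq hq' hu]
  ring

theorem formSD_smul_add_right (hd : d ≠ 0) (σ δ : ℝ) (hν : IsW1Infty Ω ν G) {v : Vec d → Vec d}
    (hv : v ∈ velocitySpace Ω T k) {q : Vec d → ℝ} (hq : q ∈ PwPoly Ω T l) {u u' : Vec d → Vec d}
    (hu : u ∈ velocitySpace Ω T k) (hu' : u' ∈ velocitySpace Ω T k) {p p' : Vec d → ℝ}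
    (hp : p ∈ PwPoly Ω T l) (hp' : p' ∈ PwPoly Ω T l) (a : ℝ) :
    formSD Ω T σ δ ν G v q (a • u + u') (a • p + p') =
      a * formSD Ω T σ δ ν G v q u p + formSD Ω T σ δ ν G v q u' p' := by
  have hua : a • u + u' ∈ velocitySpace Ω T k :=
    (velocitySubmodule Ω T k).add_mem ((velocitySubmodule Ω T k).smul_mem a hu) hu'
  rw [formSD_eq hT σ δ hν.memLp hν.memLp_grad hua hv (pwPoly_smul_add hp hp' a) hq,
    formSD_eq hT σ δ hν.memLp hν.memLp_grad hu hv hp hq,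
    formSD_eq hT σ δ hν.memLp hν.memLp_grad hu' hv hp' hq,
    integral_congr_ae (volumeIntegrand_smul_add_right hT σ δ hu hu' hp hp' a v q),
    integral_add ((integrable_volumeIntegrand hT σ δ hν.memLp hν.memLp_grad hu hv hp
      hq).const_mul a)
      (integrable_volumeIntegrand hT σ δ hν.memLp hν.memLp_grad hu' hv hp' hq),
    integral_const_mul, boundaryTerm_smul_add_right hT hd hν.continuousOn hq hu hu']
  ring

end

/-! ### Unique solvability -/

theorem gradient_zero_fun (x : Vec d) : gradient (0 : Vec d → ℝ) x = 0 := by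
  ext i
  rw [gradient_apply, fderiv_zero]
  rfl

theorem grad_zero (x : Vec d) : grad (0 : Vec d → Vec d) x = 0 := by
  ext i j
  rw [grad, fderiv_zero]
  rfl

theorem boundaryTerm_zero (Ω : Set (Vec d)) (T : Finset (Finset (Vec d))) (ν : Vec d → ℝ)
    (u : Vec d → Vec d) : boundaryTerm Ω T ν 0 u = 0 := by
  have h (s : Set (Vec d)) (x : Vec d) : gradientWithin (0 : Vec d → ℝ) s x = 0 := by
    ext i
    rw [gradientWithin_apply, fderivWithin_zero]
    rfl
  simp [boundaryTerm, h, crossCurl]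

theorem momentumForm_zero (Ω : Set (Vec d)) (σ : ℝ) (ν : Vec d → ℝ) (u : Vec d → Vec d)
    (p : Vec d → ℝ) : momentumForm Ω σ ν u p 0 = 0 := by
  simp [momentumForm, symGrad, divg, grad_zero, frob]

theorem continuityForm_zero (Ω : Set (Vec d)) (T : Finset (Finset (Vec d))) (σ δ : ℝ)
    (ν : Vec d → ℝ) (G f : Vec d → Vec d) (u : Vec d → Vec d) (p : Vec d → ℝ) :
    continuityForm Ω T σ δ ν G f u p 0 = 0 := by
  simp [continuityForm, gradient_zero_fun, boundaryTerm_zero]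

/-- A positive definite bilinear form on a finite-dimensional space represents every functional. -/
theorem existsUnique_of_posDef {W : Type*} [AddCommGroup W] [Module ℝ W] [FiniteDimensional ℝ W]
    (A : W →ₗ[ℝ] W →ₗ[ℝ] ℝ) (hA : ∀ w, A w w ≤ 0 → w = 0) (F : W →ₗ[ℝ] ℝ) :
    ∃! w, ∀ w', A w' w = F w' := by
  have hinj : Function.Injective A.flip := by
    rw [injective_iff_map_eq_zero]
    intro w hw
    exact hA w (le_of_eq (congrArg (fun φ : W →ₗ[ℝ] ℝ => φ w) hw))
  have hsurj : Function.Surjective A.flip :=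
    (LinearMap.injective_iff_surjective_of_finrank_eq_finrank
      (Subspace.dual_finrank_eq (K := ℝ) (V := W)).symm).1 hinj
  obtain ⟨w, hw⟩ := hsurj F
  refine ⟨w, fun w' => congrArg (fun φ : W →ₗ[ℝ] ℝ => φ w') hw, fun w₂ h₂ => hinj ?_⟩
  rw [hw]
  exact LinearMap.ext h₂

section
variable {Ω : Set (Vec d)} {T : Finset (Finset (Vec d))} {k l : ℕ} (hT : IsTriangulation Ω T)
  {ν : Vec d → ℝ} {G f : Vec d → Vec d}

/-- The stabilised form as a bilinear map on `X_h × Y_h`. -/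
noncomputable def bilinSD (hd : d ≠ 0) (k l : ℕ) (σ δ : ℝ) (hν : IsW1Infty Ω ν G) :
    (velocitySubmodule Ω T k × pressureSubmodule hT l) →ₗ[ℝ]
      (velocitySubmodule Ω T k × pressureSubmodule hT l) →ₗ[ℝ] ℝ :=
  LinearMap.mk₂ ℝ (fun w' w => formSD Ω T σ δ ν G w'.1.1 w'.2.1.1 w.1.1 w.2.1.1)
    (fun w₁ w₂ w => by
      simpa using formSD_smul_add_left hT hd σ δ hν w₁.1.2 w₂.1.2 w₁.2.1.2 w₂.2.1.2 w.1.2 w.2.1.2 1)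
    -- `a • w = (a - 1) • w + w` gives homogeneity.
    (fun a w₁ w => by
      have h := formSD_smul_add_left hT hd σ δ hν w₁.1.2 w₁.1.2 w₁.2.1.2 w₁.2.1.2 w.1.2
        w.2.1.2 (a - 1)
      simp only [sub_smul, one_smul, sub_add_cancel] at h
      exact h.trans (by rw [smul_eq_mul]; ring))
    (fun w w₁ w₂ => by
      simpa using formSD_smul_add_right hT hd σ δ hν w.1.2 w.2.1.2 w₁.1.2 w₂.1.2 w₁.2.1.2
        w₂.2.1.2 1)
    (fun a w w₁ => by
      have h := formSD_smul_add_right hT hd σ δ hν w.1.2 w.2.1.2 w₁.1.2 w₁.1.2 w₁.2.1.2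
        w₁.2.1.2 (a - 1)
      simp only [sub_smul, one_smul, sub_add_cancel] at h
      exact h.trans (by rw [smul_eq_mul]; ring))

include hT

theorem integrable_velocity_inner (hf : MemLp f 2 (volume.restrict Ω)) {v : Vec d → Vec d}
    (hv : v ∈ velocitySpace Ω T k) : Integrable (fun x => ⟪v x, f x⟫) (volume.restrict Ω) :=
  integrable_inner_of_memLp_two (memLp_two_velocity hT hv) hf

theorem integrable_gradient_inner (hf : MemLp f 2 (volume.restrict Ω)) {q : Vec d → ℝ}
    (hq : q ∈ PwPoly Ω T l) : Integrable (fun x => ⟪gradient q x, f x⟫) (volume.restrict Ω) :=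
  integrable_inner_of_memLp_two (memLp_two_gradient hT hq) hf

theorem load_smul_add (δ : ℝ) (hf : MemLp f 2 (volume.restrict Ω)) {v v' : Vec d → Vec d}
    (hv : v ∈ velocitySpace Ω T k) (hv' : v' ∈ velocitySpace Ω T k) {q q' : Vec d → ℝ}
    (hq : q ∈ PwPoly Ω T l) (hq' : q' ∈ PwPoly Ω T l) (a : ℝ) :
    (∫ x in Ω, ⟪(a • v + v') x, f x⟫) + δ * ∫ x in Ω, ⟪gradient (a • q + q') x, f x⟫ =
      a * ((∫ x in Ω, ⟪v x, f x⟫) + δ * ∫ x in Ω, ⟪gradient q x, f x⟫) +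
      ((∫ x in Ω, ⟪v' x, f x⟫) + δ * ∫ x in Ω, ⟪gradient q' x, f x⟫) := by
  have h1 : ∫ x in Ω, ⟪(a • v + v') x, f x⟫ =
      a * (∫ x in Ω, ⟪v x, f x⟫) + ∫ x in Ω, ⟪v' x, f x⟫ := by
    rw [← integral_const_mul, ← integral_add ((integrable_velocity_inner hT hf hv).const_mul a)
      (integrable_velocity_inner hT hf hv')]
    simp only [Pi.add_apply, Pi.smul_apply, inner_add_left, real_inner_smul_left]
  have h2 : ∫ x in Ω, ⟪gradient (a • q + q') x, f x⟫ =
      a * (∫ x in Ω, ⟪gradient q x, f x⟫) + ∫ x in Ω, ⟪gradient q' x, f x⟫ := by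
    rw [← integral_const_mul, ← integral_add ((integrable_gradient_inner hT hf hq).const_mul a)
      (integrable_gradient_inner hT hf hq')]
    refine integral_congr_ae ?_
    filter_upwards [ae_differentiableAt_pwPoly hT hq, ae_differentiableAt_pwPoly hT hq']
      with x h3 h4
    rw [gradient_smul_add h3 h4, inner_add_left, real_inner_smul_left]
  rw [h1, h2]
  ring

/-- The right-hand side `(v, f) + δ (∇q, f)` of the combined system as a functional on
`X_h × Y_h`. -/
noncomputable def loadSD (k l : ℕ) (δ : ℝ) (hf : MemLp f 2 (volume.restrict Ω)) :
    (velocitySubmodule Ω T k × pressureSubmodule hT l) →ₗ[ℝ] ℝ where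
  toFun w := (∫ x in Ω, ⟪w.1.1 x, f x⟫) + δ * ∫ x in Ω, ⟪gradient w.2.1.1 x, f x⟫
  map_add' w w' := by
    simpa using load_smul_add hT δ hf w.1.2 w'.1.2 w.2.1.2 w'.2.1.2 1
  map_smul' a w := by
    have h := load_smul_add hT δ hf w.1.2 w.1.2 w.2.1.2 w.2.1.2 (a - 1)
    simp only [sub_smul, one_smul, sub_add_cancel] at h
    exact h.trans (by rw [RingHom.id_apply, smul_eq_mul]; ring)

theorem continuityForm_eq (σ δ : ℝ) (hν : IsW1Infty Ω ν G) (hf : MemLp f 2 (volume.restrict Ω))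
    {u : Vec d → Vec d} (hu : u ∈ velocitySpace Ω T k) {p q : Vec d → ℝ} (hp : p ∈ PwPoly Ω T l)
    (hq : q ∈ PwPoly Ω T l) :
    continuityForm Ω T σ δ ν G f u p q =
      continuityForm Ω T σ δ ν G 0 u p q - δ * ∫ x in Ω, ⟪gradient q x, f x⟫ := by
  have h : ∫ x in Ω, ⟪gradient q x, gradient p x + σ • u x - viscousResidual G u x - f x⟫ =
      (∫ x in Ω, ⟪gradient q x, gradient p x + σ • u x - viscousResidual G u x⟫)
        - ∫ x in Ω, ⟪gradient q x, f x⟫ := by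
    rw [← integral_sub (integrable_residual_zero hT hν.memLp_grad σ hu hp hq)
      (integrable_gradient_inner hT hf hq)]
    simp only [inner_sub_right]
  simp only [continuityForm, h, Pi.zero_apply, sub_zero]
  ring

/-- The two equations of the discrete problem are equivalent to one equation for the stabilised
form. -/
theorem isDiscreteSolution_iff (σ δ : ℝ) (hν : IsW1Infty Ω ν G)
    (hf : MemLp f 2 (volume.restrict Ω)) {u : Vec d → Vec d} (hu : u ∈ velocitySpace Ω T k)
    {p : Vec d → ℝ} (hp : p ∈ pressureSpace Ω T l) :
    IsDiscreteSolution Ω T k l σ δ ν G f u p ↔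
      ∀ v ∈ velocitySpace Ω T k, ∀ q ∈ pressureSpace Ω T l, formSD Ω T σ δ ν G v q u p =
        (∫ x in Ω, ⟪v x, f x⟫) + δ * ∫ x in Ω, ⟪gradient q x, f x⟫ := by
  refine ⟨fun h v hv q hq => ?_, fun h => ⟨hu, hp, fun v hv => ?_, fun q hq => ?_⟩⟩
  · have h1 := h.momentum v hv
    have h2 := h.continuity q hq
    rw [continuityForm_eq hT σ δ hν hf hu hp.1 hq.1] at h2
    rw [formSD, h1]
    linarith
  · have h1 := h v hv 0 ⟨zero_mem_pwPoly Ω T l, by simp⟩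
    simpa [formSD, continuityForm_zero, gradient_zero_fun] using h1
  · have h1 := h 0 (velocitySubmodule Ω T k).zero_mem q hq
    rw [continuityForm_eq hT σ δ hν hf hu hp.1 hq.1]
    simp only [formSD, momentumForm_zero, Pi.zero_apply, inner_zero_left, integral_zero] at h1
    linarith

theorem existsUnique_isDiscreteSolution (hd : d ≠ 0) {σ δ νmin : ℝ} (hσ : 0 < σ) (hδ : 0 < δ)
    (hνmin : 0 < νmin) (hν : IsW1Infty Ω ν G) (hf : MemLp f 2 (volume.restrict Ω))
    (hcoer : ∀ v ∈ velocitySpace Ω T k, ∀ q ∈ pressureSpace Ω T l,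
      (1 / 2) * energyNorm Ω σ νmin δ v q ^ 2 ≤ formSD Ω T σ δ ν G v q v q) :
    ∃! w : (Vec d → Vec d) × (Vec d → ℝ), IsDiscreteSolution Ω T k l σ δ ν G f w.1 w.2 := by
  have := finiteDimensional_velocitySubmodule hT k
  have := finiteDimensional_pwPolySubmodule hT l
  have hpos : ∀ w, bilinSD hT hd k l σ δ hν w w ≤ 0 → w = 0 := by
    intro w hw
    have hw' : formSD Ω T σ δ ν G w.1.1 w.2.1.1 w.1.1 w.2.1.1 ≤ 0 := hw
    have hq : w.2.1.1 ∈ pressureSpace Ω T l := ⟨w.2.1.2, w.2.2⟩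
    have h := (hcoer w.1.1 w.1.2 w.2.1.1 hq).trans hw'
    rw [energyNorm_sq hσ.le hνmin.le hδ.le] at h
    have h1 : 0 ≤ ∫ x in Ω, ‖w.1.1 x‖ ^ 2 := integral_nonneg fun _ => sq_nonneg _
    have h2 : 0 ≤ ∫ x in Ω, frob (grad w.1.1 x) (grad w.1.1 x) :=
      integral_nonneg fun _ => frob_self_nonneg _
    have h3 : 0 ≤ ∫ x in Ω, ‖gradient w.2.1.1 x‖ ^ 2 := integral_nonneg fun _ => sq_nonneg _
    have h2' := mul_nonneg hνmin.le h2
    have hv0 : ∫ x in Ω, ‖w.1.1 x‖ ^ 2 = 0 := by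
      refine le_antisymm (le_of_not_gt fun hlt => ?_) h1
      nlinarith [mul_pos hσ hlt, mul_nonneg hδ.le h3]
    have hq0 : ∫ x in Ω, ‖gradient w.2.1.1 x‖ ^ 2 = 0 := by
      refine le_antisymm (le_of_not_gt fun hlt => ?_) h3
      nlinarith [mul_pos hδ hlt, mul_nonneg hσ.le h1]
    exact Prod.ext (Subtype.ext (velocity_eq_zero_of_integral hT w.1.2 hv0))
      (Subtype.ext (Subtype.ext (pressure_eq_zero_of_integral hT hq hq0)))
  obtain ⟨w, hw, huniq⟩ := existsUnique_of_posDef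
    (W := velocitySubmodule Ω T k × pressureSubmodule hT l) (bilinSD hT hd k l σ δ hν) hpos
    (loadSD hT k l δ hf)
  refine ⟨(w.1.1, w.2.1.1), ?_, fun z hz => ?_⟩
  · exact (isDiscreteSolution_iff hT σ δ hν hf w.1.2 ⟨w.2.1.2, w.2.2⟩).2 fun v hv q hq =>
      hw (⟨v, hv⟩, ⟨⟨q, hq.1⟩, hq.2⟩)
  · have hz' := (isDiscreteSolution_iff hT σ δ hν hf hz.velocity_mem hz.pressure_mem).1 hz
    have := huniq (⟨z.1, hz.velocity_mem⟩, ⟨⟨z.2, hz.pressure_mem.1⟩, hz.pressure_mem.2⟩)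
      fun w' => hz' w'.1.1 w'.1.2 w'.2.1.1 ⟨w'.2.1.2, w'.2.2⟩
    rw [← this]

end

end BVS


theorem mainTheorem1
    (d : ℕ) (hd : d = 2 ∨ d = 3) (k l : ℕ) (hk : 1 ≤ k) (hl : 1 ≤ l)
    (κ Q : ℝ) (hκ : 0 < κ) (hQ : 1 ≤ Q) :
    ∃ C : ℝ, 0 < C ∧
      ∀ (Ω : Set (BVS.Vec d)) (T : Finset (Finset (BVS.Vec d))),
        BVS.IsTriangulation Ω T → BVS.ShapeRegular κ T → BVS.QuasiUniform Q T →
      ∀ (σ νmin νmax : ℝ) (ν : BVS.Vec d → ℝ) (G f : BVS.Vec d → BVS.Vec d),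
        0 < σ → 0 < νmin → BVS.IsW1Infty Ω ν G → (∀ x ∈ Ω, νmin ≤ ν x ∧ ν x ≤ νmax) →
        MemLp f 2 (volume.restrict Ω) →
      ∀ δ : ℝ, 0 < δ →
        δ ≤ min (1 / (3 * σ))
          ((νmin * BVS.meshSize T ^ 2 / 12) /
            (BVS.meshSize T ^ 2 * BVS.supNorm Ω G ^ 2 + C * νmax ^ 2)) →
        (∀ v ∈ BVS.velocitySpace Ω T k, ∀ q ∈ BVS.pressureSpace Ω T l,
          (1 / 2) * BVS.energyNorm Ω σ νmin δ v q ^ 2 ≤ BVS.formSD Ω T σ δ ν G v q v q) ∧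
        ∃! w : (BVS.Vec d → BVS.Vec d) × (BVS.Vec d → ℝ),
          BVS.IsDiscreteSolution Ω T k l σ δ ν G f w.1 w.2 := by
  have hd0 : d ≠ 0 := by omega
  obtain ⟨C, hC, hbd⟩ := BVS.exists_abs_boundaryTerm_le hd0 k l hκ hQ
  -- Young's inequality with weight `1 / 6` turns the constant `C` of the boundary estimate into
  -- `3 C² / 2 = 6 (C² / 4)`, to be absorbed together with the contribution `6 ‖∇ν‖_∞²`.
  refine ⟨C ^ 2 / 4, by positivity, fun Ω T hT hκT hQT σ νmin νmax ν G f hσ hνmin hν hνle hf δ hδ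
    hδle => ?_⟩
  have hh := hT.meshSize_pos hd0
  have hνmax : 0 < νmax := by
    obtain ⟨x, hx⟩ := hT.isConnected.nonempty
    exact hνmin.trans_le ((hνle x hx).1.trans (hνle x hx).2)
  have hδσ : δ * σ ≤ 1 / 3 := by
    have h := hδle.trans (min_le_left _ _)
    rw [le_div_iff₀ (by positivity)] at h
    linarith
  have hδν : δ * (12 * BVS.supNorm Ω G ^ 2 + 3 * (C * (νmax / BVS.meshSize T)) ^ 2) ≤ νmin := by
    have h := hδle.trans (min_le_right _ _)
    rw [le_div_iff₀ (by positivity)] at h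
    have h2 : δ * (12 * BVS.supNorm Ω G ^ 2 + 3 * (C * (νmax / BVS.meshSize T)) ^ 2) =
        12 * (δ * (BVS.meshSize T ^ 2 * BVS.supNorm Ω G ^ 2 + C ^ 2 / 4 * νmax ^ 2)) /
          BVS.meshSize T ^ 2 := by
      field_simp
      ring
    rw [h2, div_le_iff₀ (by positivity)]
    linarith
  have hcoer : ∀ v ∈ BVS.velocitySpace Ω T k, ∀ q ∈ BVS.pressureSpace Ω T l,
      (1 / 2) * BVS.energyNorm Ω σ νmin δ v q ^ 2 ≤ BVS.formSD Ω T σ δ ν G v q v q :=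
    fun v hv q hq => BVS.half_energyNorm_sq_le_formSD hT hσ hδ hνmin hν.memLp
      (fun x hx => (hνle x hx).1) hν.memLp_grad hδσ hδν hv hq.1
      (hbd Ω T hT hκT hQT ν νmax hν.continuousOn
        (fun x hx => ⟨hνmin.le.trans (hνle x hx).1, (hνle x hx).2⟩) v hv q hq.1)
  exact ⟨hcoer, BVS.existsUnique_isDiscreteSolution hT hd0 hσ hδ hνmin hν hf hcoer⟩
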